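/- Throughout, $G$ is a finite connected simple graph that is claw-free (no induced $K_{1,3}$) and a block graph (every block, i.e. every maximal connected subgraph without a cut vertex, is a clique). $G$ is rooted at a block $R$, $k>\omega(G)$ is an integer, and $W$ is a set of vertices of $G$, each of degree at least $k-1$. For a block $C\neq R$ let $P$ be its parent block and $c$ the cut vertex that separates $C$ from $P$. **The network $\mathcal F(G,W)$** has the following nodes with capacities. For every block $B$: a node $B_x$ of capacity $1$ for each $x\in B$, and a node $(B)$ of capacity $k-|B|$. For every block $C\ne R$ with parent $P$ and cut vertex $c$: a node $(C,P)$, of capacity $k-1$ if $c\notin W$ and $d_G(c)-k+1$ if $c\in W$; and, if $c\in W$, a source $\langle c\rangle$. For every such $C,P,c$ the arcs are: $C_c\to P_c$; $C_x\to (C,P)$ for $x\in C\setminus\{c\}$; $(C,P)\to P_x$ for $x\in P\setminus\{c\}$; if $c\notin W$, also $(C)\to(C,P)$ and $(C,P)\to(P)$; if $c\in W$, also $C_x\to(P)$ for $x\in C\setminus\{c\}$, $(C)\to P_x$ for $x\in P\setminus\{c\}$, and $\langle c\rangle\to C_c$. The sinks are $(R)$ and the nodes $R_x$, $x\in R$.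 A **flow** is a family $f=(p_w)_{w\in W}$ of directed paths, $p_w$ from $\langle w\rangle$ to a sink, such that each non-source node lies on at most as many of these paths as its capacity. A vertex $x$ is *saturated* by a path if the path contains a node $B_x$ (for some block $B\ni x$) or $\langle x\rangle$. Number the elements of $W$ injectively by colors in $\{1,\dots,k\}$, and write $p_i$ for $p_w$ if $w$ has number $i$. A proper $k$-coloring $\psi$ of $G$ is a **flow coloring** of $f$ (for this numbering) if every vertex $x$ saturated by some path of $f$ is saturated by $p_{\psi(x)}$. A vertex $u$ *realizes* the color $\psi(u)$ if $u$ has a neighbor in each of the other $k-1$ colors. **Theorem 1.** $\mathcal F(G,W)$ admits a flow if and only if $G$ has a proper $k$-coloring in which the vertices of $W$ realize pairwise distinct colors. More precisely: 1. for every flow $f$ and every numbering of $W$ there is a flow coloring $\psi$ of $f$ in which the vertices of $W$ realize pairwise distinct colors; 2. conversely, if $\psi$ is a proper $k$-coloring in which the vertices of $W$ realize pairwise distinct colors, then $\psi$ is a flow coloring of some flow in $\mathcal F(G,W)$, where each $w\in W$ is numbered by its color $\psi(w)$. -/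

import Mathlib

namespace BlockFlow

/-! ### Block graphs -/

section Blocks

variable {V : Type*}

/-- `S` induces a connected subgraph without a cut vertex. -/
def IsNonseparable (G : SimpleGraph V) (S : Finset V) : Prop :=
  (G.induce (S : Set V)).Connected ∧
    ∀ v ∈ S, (G.induce ((S : Set V) \ {v})).Preconnected

/-- `B` is (the vertex set of) a block of `G`: a maximal connected subgraph without a cut vertex. -/
def IsBlock (G : SimpleGraph V) (B : Finset V) : Prop :=
  Maximal (IsNonseparable G) B

/-- Every block of `G` is a clique. -/
def IsBlockGraph (G : SimpleGraph V) : Prop :=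
  ∀ B : Finset V, IsBlock G B → G.IsClique (B : Set V)

/-- `G` has no induced subgraph isomorphic to `K_{1,3}`. -/
def IsClawFree (G : SimpleGraph V) : Prop :=
  ¬ (completeBipartiteGraph (Fin 1) (Fin 3)).IsIndContained G

/-- Every walk of `G` from a vertex of `B` to a vertex of `R` passes through `c`. -/
def Separates (G : SimpleGraph V) (c : V) (B R : Finset V) : Prop :=
  ∀ y ∈ B, ∀ z ∈ R, ∀ p : G.Walk y z, c ∈ p.support

/-- In the graph `G` rooted at the block `R`, the block `P` is the parent block of the block `C`,
and `c` is the cut vertex that separates `C` from `P`: the vertex `c` lies in both blocks, it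
separates the block `C` from the root, and it does not separate the block `P` from the root. -/
structure IsChild (G : SimpleGraph V) (R C P : Finset V) (c : V) : Prop where
  block_child : IsBlock G C
  block_parent : IsBlock G P
  mem_child : c ∈ C
  mem_parent : c ∈ P
  separates_child : Separates G c C R
  not_separates_parent : ¬ Separates G c P R

end Blocks

/-! ### Networks with node capacities -/

/-- A directed network with capacities on the nodes. -/
structure Network (N : Type*) where
  nodes : Set N
  Arc : N → N → Prop
  cap : N → ℕ
  sources : Set N
  sinks : Set N

/-- `p` is the list of nodes of a directed path of the network `F` (no node is repeated). -/
def Network.IsPath {N : Type*} (F : Network N) (p : List N) : Prop :=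
  p ≠ [] ∧ (∀ γ ∈ p, γ ∈ F.nodes) ∧ p.IsChain F.Arc ∧ p.Nodup

/-! ### The flow network of a rooted block graph -/

/-- Names for the nodes of the flow network. -/
inductive Node (V : Type*) where
  /-- the node `B_x`, for a vertex `x` of a block `B` -/
  | vert (B : Finset V) (x : V) : Node V
  /-- the cash-node `(B)` of a block `B` -/
  | cash (B : Finset V) : Node V
  /-- the cash-node `(C, P)`, for a block `C` with parent block `P` and common vertex `c` -/
  | link (C P : Finset V) (c : V) : Node V
  /-- the source `⟨x⟩` -/
  | source (x : V) : Node V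

section FlowNetwork

variable {V : Type*}

/-- The nodes that are present in the flow network. -/
inductive IsNode (G : SimpleGraph V) (R W : Finset V) : Node V → Prop
  | vert {B : Finset V} {x : V} (hB : IsBlock G B) (hx : x ∈ B) : IsNode G R W (.vert B x)
  | cash {B : Finset V} (hB : IsBlock G B) : IsNode G R W (.cash B)
  | link {C P : Finset V} {c : V} (h : IsChild G R C P c) : IsNode G R W (.link C P c)
  | source {C P : Finset V} {c : V} (h : IsChild G R C P c) (hc : c ∈ W) :
      IsNode G R W (.source c)

/-- The arcs of the flow network. The first three kinds are present whether or not the common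
vertex `c` of the block `C` and its parent block `P` belongs to `W`; the next two are present
when `c ∉ W`, and the last three when `c ∈ W`. -/
inductive FlowArc (G : SimpleGraph V) (R W : Finset V) : Node V → Node V → Prop
  | vert_vert {C P : Finset V} {c : V} (h : IsChild G R C P c) :
      FlowArc G R W (.vert C c) (.vert P c)
  | vert_link {C P : Finset V} {c x : V} (h : IsChild G R C P c) (hx : x ∈ C) (hxc : x ≠ c) :
      FlowArc G R W (.vert C x) (.link C P c)
  | link_vert {C P : Finset V} {c x : V} (h : IsChild G R C P c) (hx : x ∈ P) (hxc : x ≠ c) :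
      FlowArc G R W (.link C P c) (.vert P x)
  | cash_link {C P : Finset V} {c : V} (h : IsChild G R C P c) (hc : c ∉ W) :
      FlowArc G R W (.cash C) (.link C P c)
  | link_cash {C P : Finset V} {c : V} (h : IsChild G R C P c) (hc : c ∉ W) :
      FlowArc G R W (.link C P c) (.cash P)
  | vert_cash {C P : Finset V} {c x : V} (h : IsChild G R C P c) (hc : c ∈ W)
      (hx : x ∈ C) (hxc : x ≠ c) : FlowArc G R W (.vert C x) (.cash P)
  | cash_vert {C P : Finset V} {c x : V} (h : IsChild G R C P c) (hc : c ∈ W)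
      (hx : x ∈ P) (hxc : x ≠ c) : FlowArc G R W (.cash C) (.vert P x)
  | source_vert {C P : Finset V} {c : V} (h : IsChild G R C P c) (hc : c ∈ W) :
      FlowArc G R W (.source c) (.vert C c)

/-- The capacities of the nodes. The truncated subtractions are used only where they are exact:
`k` exceeds the size of every clique, and vertices of `W` have degree at least `k - 1`.
The value at a source is its one unit of supply. -/
def nodeCap [Fintype V] [DecidableEq V] (G : SimpleGraph V) [DecidableRel G.Adj]
    (k : ℕ) (W : Finset V) : Node V → ℕ
  | .vert _ _ => 1
  | .cash B => k - B.card
  | .link _ _ c => if c ∈ W then G.degree c + 1 - k else k - 1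
  | .source _ => 1

/-- The flow network related to `(G, W)`, where `G` is rooted at the block `R`. -/
def flowNetwork [Fintype V] [DecidableEq V] (G : SimpleGraph V) [DecidableRel G.Adj]
    (R : Finset V) (k : ℕ) (W : Finset V) : Network (Node V) where
  nodes := {γ | IsNode G R W γ}
  Arc := FlowArc G R W
  cap := nodeCap G k W
  sources := {γ | IsNode G R W γ ∧ ∃ x, γ = .source x}
  sinks := {γ | γ = .cash R ∨ ∃ x ∈ R, γ = .vert R x}

/-- `f` is a flow in the network `F`: for each `w ∈ W`, `f w` is a directed path from the source
`⟨w⟩` to a sink, and the number of these paths through each non-source node is at most its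
capacity. -/
def IsFlow {W : Finset V} (F : Network (Node V)) (f : W → List (Node V)) : Prop :=
  (∀ w : W, F.IsPath (f w) ∧ (f w).head? = some (.source (w : V)) ∧
    ∃ t ∈ F.sinks, (f w).getLast? = some t) ∧
  ∀ γ ∈ F.nodes, γ ∉ F.sources → {w : W | γ ∈ f w}.ncard ≤ F.cap γ

/-! ### Colorings -/

/-- The set of `k`-dense vertices: those of degree at least `k - 1`. -/
def denseSet [Fintype V] (G : SimpleGraph V) [DecidableRel G.Adj] (k : ℕ) : Set V :=
  {v | k ≤ G.degree v + 1}

/-- In the proper coloring `ψ`, the vertex `u` realizes the color `i`. -/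
def Realizes {G : SimpleGraph V} {k : ℕ} (ψ : G.Coloring (Fin k)) (u : V) (i : Fin k) : Prop :=
  ψ u = i ∧ ∀ j, j ≠ i → ∃ v, G.Adj u v ∧ ψ v = j

/-- In the proper coloring `ψ`, every vertex of `W` realizes a color, and these colors are
pairwise distinct. -/
def RealizesDistinct {G : SimpleGraph V} {k : ℕ} (ψ : G.Coloring (Fin k)) (W : Finset V) : Prop :=
  (∀ w ∈ W, ∃ i, Realizes ψ w i) ∧ Set.InjOn ψ (W : Set V)

/-- The nodes of the flow network related to the vertex `x`. -/
def relatedNodes (G : SimpleGraph V) (W : Finset V) (x : V) : Set (Node V) :=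
  {γ | (∃ B, IsBlock G B ∧ x ∈ B ∧ γ = .vert B x) ∨ (x ∈ W ∧ γ = .source x)}

/-- The vertex `x` is saturated by the path `p`. -/
def SaturatedBy (G : SimpleGraph V) (W : Finset V) (x : V) (p : List (Node V)) : Prop :=
  ∃ γ ∈ p, γ ∈ relatedNodes G W x

/-- The vertex `x` is flow colored in `ψ` according to `f`: it is saturated by the path of `f`
whose index is the color of `x`. Here `index w` is the index of `w` in the numbering of `W`
(and of the paths of `f`) by elements of `{1, …, k}`. -/
def IsFlowColored {G : SimpleGraph V} {k : ℕ} {W : Finset V} (index : W ↪ Fin k)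
    (f : W → List (Node V)) (ψ : G.Coloring (Fin k)) (x : V) : Prop :=
  ∃ w : W, index w = ψ x ∧ SaturatedBy G W x (f w)

/-- The proper `k`-coloring `ψ` is a flow coloring of `f`: every vertex that is saturated by some
path of `f` is flow colored. -/
def IsFlowColoring {G : SimpleGraph V} {k : ℕ} {W : Finset V} (index : W ↪ Fin k)
    (f : W → List (Node V)) (ψ : G.Coloring (Fin k)) : Prop :=
  ∀ x : V, (∃ w : W, SaturatedBy G W x (f w)) → IsFlowColored index f ψ x

end FlowNetwork

end BlockFlow

open BlockFlow

/-! The path numbered `i` is the trace of color `i` on its way to the root: passing through `B_x`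
means that `x` has color `i`, passing through `(B)` means that color `i` is missing from `B`.

Claw-freeness puts every vertex in at most two blocks (`IsClawFree.block_eq_or_eq`). A cut vertex
`c` thus determines its child `C` and parent `P`, and `d(c) = |C| + |P| - 2`. Blocks have fewer than
`k` vertices, so a vertex of degree at least `k - 1` is such a cut vertex. In a proper coloring it
realizes its color exactly when at most `d(c) - k + 1` colors occur on both `C \ {c}` and `P \ {c}`;
this number is the capacity of `(C, P)` for `c ∈ W`.

From a flow to a coloring: color the blocks from the root downwards, keeping `RespectsOn` true. A
path that meets `C` away from `c` also meets `P` away from `c`, so the colors forced on `C` never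
clash with the color of `c`. If `c ∈ W`, the colors still missing around `c` must be placed on `C \
{c}`, and the capacities leave enough room for them (`IsFlow.exists_respectsOn_child`).

From a coloring to a flow: color `i` climbs from block to block, through `B_x` if `x ∈ B` has color
`i` and through `(B)` otherwise (`reachesSink_of_isBlock`). At most as many colors can use a node as
its capacity allows (`exists_finset_ofColor`), and distinct elements of `W` have distinct colors. -/

namespace BlockFlow

/-! ### Blocks of block graphs and of claw-free block graphs -/

section BlockGraphs

variable {V : Type*} {G : SimpleGraph V}

lemma preconnected_induce_of_forall_adj {T : Set V} {x : V} (hx : x ∈ T)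
    (h : ∀ y ∈ T, y ≠ x → G.Adj x y) : (G.induce T).Preconnected := by
  have key : ∀ y : T, (G.induce T).Reachable ⟨x, hx⟩ y := by
    rintro ⟨y, hy⟩
    by_cases hxy : y = x
    · subst hxy; exact .refl _
    · exact SimpleGraph.Adj.reachable (by simpa using h y hy hxy)
  exact fun a b => (key a).symm.trans (key b)

lemma isNonseparable_of_isClique {S : Finset V} (h : G.IsClique (S : Set V)) (hS : S.Nonempty) :
    IsNonseparable G S := by
  have key : ∀ T : Set V, T ⊆ S → (G.induce T).Preconnected := by
    intro T hT
    rcases T.eq_empty_or_nonempty with rfl | ⟨x, hx⟩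
    · exact fun a => a.2.elim
    · exact preconnected_induce_of_forall_adj hx fun y hy hne => h (hT hx) (hT hy) hne.symm
  refine ⟨?_, fun v _ => key _ Set.sdiff_subset⟩
  have : Nonempty (S : Set V) := hS.to_subtype
  exact ⟨key _ subset_rfl⟩

lemma IsNonseparable.nonempty {S : Finset V} (h : IsNonseparable G S) : S.Nonempty := by
  obtain ⟨x, hx⟩ := h.1.nonempty
  exact ⟨x, hx⟩

lemma IsBlock.nonempty {B : Finset V} (h : IsBlock G B) : B.Nonempty := h.prop.nonempty

lemma IsNonseparable.exists_isBlock [Finite V] {S : Finset V} (h : IsNonseparable G S) :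
    ∃ B, IsBlock G B ∧ S ⊆ B := by
  obtain ⟨B, hSB, hB⟩ := Finite.exists_le_maximal h
  exact ⟨B, hB, hSB⟩

lemma exists_isBlock_of_isClique [Finite V] {S : Finset V} (h : G.IsClique (S : Set V))
    (hS : S.Nonempty) : ∃ B, IsBlock G B ∧ S ⊆ B :=
  (isNonseparable_of_isClique h hS).exists_isBlock

lemma exists_isBlock_of_adj [Finite V] {x y : V} (h : G.Adj x y) :
    ∃ B, IsBlock G B ∧ x ∈ B ∧ y ∈ B := by
  classical
  obtain ⟨B, hB, hs⟩ := exists_isBlock_of_isClique (G := G) (S := {x, y})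
    (by simp [SimpleGraph.isClique_insert, h]) (by simp)
  exact ⟨B, hB, hs (by simp), hs (by simp)⟩

/-- Deleting `v` cuts the path into at most two pieces, each of which keeps an end of the path. -/
lemma exists_walk_of_mem_support_of_ne [DecidableEq V] {y x z v : V} {p : G.Walk y x}
    (hp : p.IsPath) (hz : z ∈ p.support) (hzv : z ≠ v) :
    ∃ e, (e = y ∨ e = x) ∧ ∃ q : G.Walk e z, q.support ⊆ p.support ∧ v ∉ q.support := by
  by_cases hv : v ∈ p.support
  · have hz' := hz
    rw [← p.take_spec hv, SimpleGraph.Walk.mem_support_append_iff] at hz'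
    rcases hz' with h | h
    · refine ⟨y, .inl rfl, (p.takeUntil v hv).takeUntil z h, ?_, ?_⟩
      · exact fun a ha => SimpleGraph.Walk.support_takeUntil_subset_support p hv
          (SimpleGraph.Walk.support_takeUntil_subset_support _ _ ha)
      · exact SimpleGraph.Walk.endpoint_notMem_support_takeUntil (hp.takeUntil hv) h hzv.symm
    · have h' : z ∈ (p.dropUntil v hv).reverse.support := by simpa using h
      refine ⟨x, .inr rfl, (p.dropUntil v hv).reverse.takeUntil z h', ?_, ?_⟩
      · intro a ha
        have ha' := SimpleGraph.Walk.support_takeUntil_subset_support _ _ ha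
        exact SimpleGraph.Walk.support_dropUntil_subset_support p hv (by simpa using ha')
      · exact SimpleGraph.Walk.endpoint_notMem_support_takeUntil (hp.dropUntil hv).reverse h'
          hzv.symm
  · exact ⟨y, .inl rfl, p.takeUntil z hz, SimpleGraph.Walk.support_takeUntil_subset_support _ _,
      fun h => hv (SimpleGraph.Walk.support_takeUntil_subset_support _ _ h)⟩

/-- If `y ≠ x`, the path closes up through `c` to a cycle. After deleting a vertex other than `c`,
everything left still reaches an end of the path, and hence `c`; after deleting `c`, the path itself
remains. -/
lemma isNonseparable_of_isPath [DecidableEq V] {c y x : V} {p : G.Walk y x} (hp : p.IsPath)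
    (hy : G.Adj c y) (hx : G.Adj c x) (hc : c ∉ p.support) :
    IsNonseparable G (insert c p.support.toFinset) := by
  set S : Finset V := insert c p.support.toFinset with hS
  have hsub : ∀ z ∈ p.support, z ∈ (S : Set V) := fun z hz => by simp [hS, hz]
  have hcS : c ∈ (S : Set V) := by simp [hS]
  have key : ∀ v, v ≠ c → (G.induce ((S : Set V) \ {v})).Preconnected := by
    intro v hv
    have hcT : c ∈ (S : Set V) \ {v} := ⟨hcS, hv.symm⟩
    have main : ∀ z : ((S : Set V) \ {v} : Set V),
        (G.induce ((S : Set V) \ {v})).Reachable ⟨c, hcT⟩ z := by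
      rintro ⟨z, hzS, hzv⟩
      by_cases hzc : z = c
      · subst hzc; exact .refl _
      have hzp : z ∈ p.support := by simpa [hS, hzc] using hzS
      obtain ⟨e, he, q, hq, hvq⟩ := exists_walk_of_mem_support_of_ne hp hzp hzv
      have hce : G.Adj c e := by rcases he with rfl | rfl <;> assumption
      exact ⟨(SimpleGraph.Walk.cons hce q).induce _ (by
        intro a ha
        rw [SimpleGraph.Walk.support_cons, List.mem_cons] at ha
        rcases ha with rfl | ha
        · exact hcT
        · exact ⟨hsub a (hq ha), fun h => hvq (h ▸ ha)⟩)⟩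
    exact fun a b => (main a).symm.trans (main b)
  have hS' : ∀ z : (S : Set V), (G.induce (S : Set V)).Reachable ⟨c, hcS⟩ z := by
    rintro ⟨z, hz⟩
    by_cases hzc : z = c
    · subst hzc; exact .refl _
    have hzp : z ∈ p.support := by simpa [hS, hzc] using hz
    exact ⟨(SimpleGraph.Walk.cons hy (p.takeUntil z hzp)).induce _ (by
      intro a ha
      rw [SimpleGraph.Walk.support_cons, List.mem_cons] at ha
      rcases ha with rfl | ha
      · exact hcS
      · exact hsub a (SimpleGraph.Walk.support_takeUntil_subset_support _ _ ha))⟩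
  refine ⟨?_, fun v _ => ?_⟩
  · have : Nonempty (S : Set V) := ⟨⟨c, hcS⟩⟩
    exact ⟨fun a b => (hS' a).symm.trans (hS' b)⟩
  · by_cases hv : v = c
    · subst hv
      have main : ∀ z : ((S : Set V) \ {v} : Set V),
          (G.induce ((S : Set V) \ {v})).Reachable
            ⟨y, hsub y p.start_mem_support, fun h => hc (h ▸ p.start_mem_support)⟩ z := by
        rintro ⟨z, hzS, hzv⟩
        have hzp : z ∈ p.support := by
          have : z ≠ v := hzv
          simpa [hS, this] using hzS
        exact ⟨(p.takeUntil z hzp).induce _ (by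
          intro a ha
          have ha' := SimpleGraph.Walk.support_takeUntil_subset_support _ _ ha
          exact ⟨hsub a ha', fun h => hc (h ▸ ha')⟩)⟩
      exact fun a b => (main a).symm.trans (main b)
    · exact key v hv

lemma IsBlockGraph.eq_or_adj_of_walk [Finite V] (hG : IsBlockGraph G) {c y x : V}
    (hy : G.Adj c y) (hx : G.Adj c x) (p : G.Walk y x) (hc : c ∉ p.support) :
    y = x ∨ G.Adj y x := by
  classical
  obtain ⟨B, hB, hsub⟩ := (isNonseparable_of_isPath p.bypass_isPath hy hx
    fun h => hc (p.support_bypass_subset_support h)).exists_isBlock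
  by_cases hxy : y = x
  · exact .inl hxy
  · exact .inr (hG B hB (hsub (by simp)) (hsub (by simp)) hxy)

/-- Both blocks are cliques, so whichever vertex is deleted from the union, one of the two common
vertices survives and is adjacent to all the others. The union is therefore nonseparable, and
maximality applies. -/
lemma IsBlockGraph.eq_of_mem_of_mem (hG : IsBlockGraph G) {B B' : Finset V}
    (hB : IsBlock G B) (hB' : IsBlock G B') {x y : V} (hxy : x ≠ y) (hx : x ∈ B) (hy : y ∈ B)
    (hx' : x ∈ B') (hy' : y ∈ B') : B = B' := by
  classical
  have hub : ∀ T : Set V, T ⊆ ((B ∪ B' : Finset V) : Set V) → ∀ z, z ∈ B → z ∈ B' → z ∈ T →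
      (G.induce T).Preconnected := by
    intro T hT z hz hz' hzT
    refine preconnected_induce_of_forall_adj hzT fun u hu hne => ?_
    have := hT hu
    simp only [Finset.coe_union, Set.mem_union, Finset.mem_coe] at this
    rcases this with h | h
    · exact hG B hB hz h hne.symm
    · exact hG B' hB' hz' h hne.symm
  have hN : IsNonseparable G (B ∪ B') := by
    refine ⟨?_, fun v _ => ?_⟩
    · have : Nonempty ((B ∪ B' : Finset V) : Set V) := ⟨⟨x, by simp [hx]⟩⟩
      exact ⟨hub _ subset_rfl x hx hx' (by simp [hx])⟩
    · by_cases hv : v = x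
      · exact hub _ Set.sdiff_subset y hy hy' ⟨by simp [hy], fun h => hxy (hv.symm.trans h.symm)⟩
      · exact hub _ Set.sdiff_subset x hx hx' ⟨by simp [hx], fun h => hv h.symm⟩
  exact (hB.eq_of_le hN Finset.subset_union_left).trans
    (hB'.eq_of_le hN Finset.subset_union_right).symm

lemma IsBlock.exists_mem_ne {B B' : Finset V} (hB : IsBlock G B) (hB' : IsBlock G B')
    (hne : B ≠ B') {c : V} (hc' : c ∈ B') : ∃ x ∈ B, x ≠ c := by
  by_contra! h
  exact hne (hB.eq_of_le hB'.prop fun x hx => h x hx ▸ hc')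

lemma IsBlockGraph.eq_of_eq_or_adj [Finite V] (hG : IsBlockGraph G) {B B' : Finset V}
    (hB : IsBlock G B) (hB' : IsBlock G B') {c x y : V} (hc : c ∈ B) (hc' : c ∈ B')
    (hx : x ∈ B) (hy : y ∈ B') (hxc : x ≠ c) (hyc : y ≠ c) (h : x = y ∨ G.Adj x y) : B = B' := by
  classical
  rcases h with rfl | h
  · exact hG.eq_of_mem_of_mem hB hB' hxc hx hc hy hc'
  · obtain ⟨D, hD, hs⟩ := exists_isBlock_of_isClique (G := G) (S := {c, x, y}) (by
      simp [SimpleGraph.isClique_insert, h, (hG B hB hc hx hxc.symm), hG B' hB' hc' hy hyc.symm])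
      (by simp)
    have h1 := hG.eq_of_mem_of_mem hB hD hxc hx hc (hs (by simp)) (hs (by simp))
    have h2 := hG.eq_of_mem_of_mem hB' hD hyc hy hc' (hs (by simp)) (hs (by simp))
    exact h1.trans h2.symm

lemma IsBlockGraph.eq_of_walk [Finite V] (hG : IsBlockGraph G) {B B' : Finset V}
    (hB : IsBlock G B) (hB' : IsBlock G B') {c x y : V} (hc : c ∈ B) (hc' : c ∈ B')
    (hx : x ∈ B) (hy : y ∈ B') (p : G.Walk x y) (hp : c ∉ p.support) : B = B' := by
  have hxc : x ≠ c := fun h => hp (h ▸ p.start_mem_support)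
  have hyc : y ≠ c := fun h => hp (h ▸ p.end_mem_support)
  exact hG.eq_of_eq_or_adj hB hB' hc hc' hx hy hxc hyc
    (hG.eq_or_adj_of_walk (hG B hB hc hx hxc.symm) (hG B' hB' hc' hy hyc.symm) p hp)

/-- One further vertex from each of three distinct blocks at `c` would give a claw centered at `c`.
-/
lemma IsClawFree.block_eq_or_eq [Finite V] (hclaw : IsClawFree G) (hG : IsBlockGraph G)
    {B₁ B₂ B₃ : Finset V} (h₁ : IsBlock G B₁) (h₂ : IsBlock G B₂) (h₃ : IsBlock G B₃) {c : V}
    (hc₁ : c ∈ B₁) (hc₂ : c ∈ B₂) (hc₃ : c ∈ B₃) (hne : B₁ ≠ B₂) : B₃ = B₁ ∨ B₃ = B₂ := by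
  by_contra! hcon
  obtain ⟨h31, h32⟩ := hcon
  obtain ⟨x₁, hx₁, hn₁⟩ := h₁.exists_mem_ne h₂ hne hc₂
  obtain ⟨x₂, hx₂, hn₂⟩ := h₂.exists_mem_ne h₁ hne.symm hc₁
  obtain ⟨x₃, hx₃, hn₃⟩ := h₃.exists_mem_ne h₁ h31 hc₁
  have n12 := mt (hG.eq_of_eq_or_adj h₁ h₂ hc₁ hc₂ hx₁ hx₂ hn₁ hn₂) hne
  have n31 := mt (hG.eq_of_eq_or_adj h₃ h₁ hc₃ hc₁ hx₃ hx₁ hn₃ hn₁) h31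
  have n32 := mt (hG.eq_of_eq_or_adj h₃ h₂ hc₃ hc₂ hx₃ hx₂ hn₃ hn₂) h32
  have a₁ := hG B₁ h₁ hc₁ hx₁ hn₁.symm
  have a₂ := hG B₂ h₂ hc₂ hx₂ hn₂.symm
  have a₃ := hG B₃ h₃ hc₃ hx₃ hn₃.symm
  push Not at n12 n31 n32
  refine hclaw ⟨⟨⟨Sum.elim (fun _ => c) ![x₁, x₂, x₃], ?_⟩, ?_⟩⟩
  · rintro (i | i) (j | j) h
    · congr 1; exact Subsingleton.elim _ _
    · fin_cases j <;> simp at h <;> simp_all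
    · fin_cases i <;> simp at h <;> simp_all
    · fin_cases i <;> fin_cases j <;> simp at h ⊢ <;> simp_all [eq_comm]
  · intro i j
    change G.Adj (Sum.elim (fun _ => c) ![x₁, x₂, x₃] i)
      (Sum.elim (fun _ => c) ![x₁, x₂, x₃] j) ↔ _
    rcases i with i | i <;> rcases j with j | j
    · simp
    · fin_cases j <;> simp [a₁, a₂, a₃]
    · fin_cases i <;> simp [a₁.symm, a₂.symm, a₃.symm]
    · fin_cases i <;> fin_cases j <;>
        simp [n12.2, n31.2, n32.2, mt G.adj_symm n12.2, mt G.adj_symm n31.2, mt G.adj_symm n32.2]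

end BlockGraphs

/-! ### Parents, cut vertices and distances to the root -/

section RootedBlockGraphs

variable {V : Type*} {G : SimpleGraph V} {R C P : Finset V} {c : V}

/-- The distance of a vertex from the vertex set `R`. -/
noncomputable def rootDist (G : SimpleGraph V) (R : Finset V) (x : V) : ℕ :=
  sInf {n | ∃ z ∈ R, ∃ p : G.Walk x z, p.length = n}

lemma rootDist_le {x z : V} (hz : z ∈ R) (p : G.Walk x z) : rootDist G R x ≤ p.length :=
  Nat.sInf_le ⟨z, hz, p, rfl⟩

lemma rootDist_eq_zero {x : V} (hx : x ∈ R) : rootDist G R x = 0 :=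
  Nat.le_zero.mp (rootDist_le hx SimpleGraph.Walk.nil)

lemma exists_walk_length_eq_rootDist (hconn : G.Connected) (hR : R.Nonempty) (x : V) :
    ∃ z ∈ R, ∃ p : G.Walk x z, p.length = rootDist G R x := by
  obtain ⟨z, hz⟩ := hR
  obtain ⟨p⟩ := hconn.preconnected x z
  exact Nat.sInf_mem (s := {n | ∃ z ∈ R, ∃ p : G.Walk x z, p.length = n}) ⟨p.length, z, hz, p, rfl⟩

lemma Separates.rootDist_lt (hconn : G.Connected) (hR : R.Nonempty)
    (h : Separates G c C R) {y : V} (hy : y ∈ C) (hyc : y ≠ c) :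
    rootDist G R c < rootDist G R y := by
  classical
  obtain ⟨z, hz, p, hp⟩ := exists_walk_length_eq_rootDist hconn hR y
  have hc := h y hy z hz p
  have h1 := rootDist_le hz (p.dropUntil c hc)
  have h2 := congrArg SimpleGraph.Walk.length (p.take_spec hc)
  rw [SimpleGraph.Walk.length_append] at h2
  have h3 : (p.takeUntil c hc).length ≠ 0 := fun h => hyc (SimpleGraph.Walk.eq_of_length_eq_zero h)
  omega

/-- If `c` is outside `R`, the block containing the first edge of a shortest walk from `c` to `R`
serves: the rest of that walk is too short to return to `c`. -/
lemma exists_block_not_separates [Finite V] (hconn : G.Connected) (hR : IsBlock G R)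
    (hC : IsBlock G C) (hCR : C ≠ R) (hc : c ∈ C) :
    ∃ P, IsBlock G P ∧ c ∈ P ∧ ¬ Separates G c P R ∧
      (P = R ∨ ∃ y ∈ P, rootDist G R y < rootDist G R c) := by
  classical
  by_cases hcR : c ∈ R
  · obtain ⟨x, hx, hxc⟩ := hR.exists_mem_ne hC hCR.symm hc
    refine ⟨R, hR, hcR, fun h => hxc ?_, .inl rfl⟩
    simpa [eq_comm] using h x hx x hx .nil
  · obtain ⟨z, hz, p, hp⟩ := exists_walk_length_eq_rootDist hconn hR.nonempty c
    cases p with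
    | nil => exact (hcR hz).elim
    | @cons _ y _ hcy q =>
      rw [SimpleGraph.Walk.length_cons] at hp
      obtain ⟨P, hP, hcP, hyP⟩ := exists_isBlock_of_adj hcy
      refine ⟨P, hP, hcP, fun h => ?_, .inr ⟨y, hyP, ?_⟩⟩
      · have hcq := h y hyP z hz q
        have h1 := rootDist_le hz (q.dropUntil c hcq)
        have h2 := congrArg SimpleGraph.Walk.length (q.take_spec hcq)
        rw [SimpleGraph.Walk.length_append] at h2
        omega
      · have := rootDist_le hz q
        omega

/-- Otherwise both blocks reach the clique `R` by walks avoiding `c`; these join up within `R`,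
which would make the two blocks equal. -/
lemma IsBlockGraph.separates_of_not_separates [Finite V] (hG : IsBlockGraph G) (hR : IsBlock G R)
    (hC : IsBlock G C) (hP : IsBlock G P) (hcC : c ∈ C) (hcP : c ∈ P)
    (hsep : ¬ Separates G c P R) (hne : C ≠ P) : Separates G c C R := by
  classical
  by_contra hcon
  unfold Separates at hsep hcon
  push Not at hsep hcon
  obtain ⟨y, hy, z, hz, p, hp⟩ := hsep
  obtain ⟨y', hy', z', hz', p', hp'⟩ := hcon
  refine hne (hG.eq_of_walk hP hC hcP hcC hy hy' ?_ ?_).symm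
  · exact p.append (if h : z = z' then p'.reverse.copy h.symm rfl
      else (SimpleGraph.Walk.cons (hG R hR hz hz' h) p'.reverse))
  · rw [SimpleGraph.Walk.mem_support_append_iff, not_or]
    refine ⟨hp, ?_⟩
    split_ifs with h
    · simpa using hp'
    · have : c ≠ z := fun h => hp (h ▸ p.end_mem_support)
      simp [hp', this]

lemma exists_isChild [Finite V] (hconn : G.Connected) (hG : IsBlockGraph G) (hR : IsBlock G R)
    (hC : IsBlock G C) (hCR : C ≠ R) : ∃ P c, IsChild G R C P c := by
  -- The vertex of `C` nearest to the root is the cut vertex towards the parent.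
  obtain ⟨c, hc, hmin⟩ := C.exists_min_image (rootDist G R) hC.nonempty
  obtain ⟨P, hP, hcP, hsep, h⟩ := exists_block_not_separates hconn hR hC hCR hc
  refine ⟨P, c, hC, hP, hc, hcP,
    hG.separates_of_not_separates hR hC hP hc hcP hsep ?_, hsep⟩
  rintro rfl
  rcases h with rfl | ⟨y, hy, hlt⟩
  · exact hCR rfl
  · exact absurd (hmin y hy) (by omega)

lemma exists_isChild_of_mem_of_mem [Finite V] (hconn : G.Connected) (hG : IsBlockGraph G)
    (hR : IsBlock G R) {B B' : Finset V} (hB : IsBlock G B) (hB' : IsBlock G B') (hne : B ≠ B')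
    (hc : c ∈ B) (hc' : c ∈ B') : ∃ C P, IsChild G R C P c := by
  obtain ⟨P, hP, hcP, hsep⟩ : ∃ P, IsBlock G P ∧ c ∈ P ∧ ¬ Separates G c P R := by
    by_cases h : B = R
    · obtain ⟨P, h1, h2, h3, -⟩ := exists_block_not_separates hconn hR hB'
        (fun h' => hne (h.trans h'.symm)) hc'
      exact ⟨P, h1, h2, h3⟩
    · obtain ⟨P, h1, h2, h3, -⟩ := exists_block_not_separates hconn hR hB h hc
      exact ⟨P, h1, h2, h3⟩
  by_cases h : B = P
  · exact ⟨B', P, hB', hP, hc', hcP, hG.separates_of_not_separates hR hB' hP hc' hcP hsep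
      fun h' => hne (h.trans h'.symm), hsep⟩
  · exact ⟨B, P, hB, hP, hc, hcP, hG.separates_of_not_separates hR hB hP hc hcP hsep h, hsep⟩

lemma IsChild.ne (h : IsChild G R C P c) : C ≠ P := by
  rintro rfl
  exact h.not_separates_parent h.separates_child

lemma IsChild.child_ne_root (h : IsChild G R C P c) : C ≠ R := by
  rintro rfl
  obtain ⟨x, hx, hxc⟩ := h.block_child.exists_mem_ne h.block_parent h.ne h.mem_parent
  exact hxc (by simpa [eq_comm] using h.separates_child x hx x hx .nil)

lemma IsChild.eq_of_mem_of_mem (h : IsChild G R C P c) (hG : IsBlockGraph G) {x : V}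
    (hx : x ∈ C) (hx' : x ∈ P) : x = c := by
  by_contra hne
  exact h.ne (hG.eq_of_mem_of_mem h.block_child h.block_parent hne hx h.mem_child hx' h.mem_parent)

lemma IsChild.blocks_eq [Finite V] (h : IsChild G R C P c) (hG : IsBlockGraph G)
    (hclaw : IsClawFree G) {C' P' : Finset V} (h' : IsChild G R C' P' c) : C' = C ∧ P' = P := by
  have key : ∀ {B}, IsBlock G B → c ∈ B → B = C ∨ B = P := fun hB hc =>
    hclaw.block_eq_or_eq hG h.block_child h.block_parent hB h.mem_child h.mem_parent hc h.ne
  constructor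
  · refine (key h'.block_child h'.mem_child).resolve_right ?_
    rintro rfl
    exact h.not_separates_parent h'.separates_child
  · refine (key h'.block_parent h'.mem_parent).resolve_left ?_
    rintro rfl
    exact h'.not_separates_parent h.separates_child

lemma IsChild.cutVertex_eq (h : IsChild G R C P c) (hconn : G.Connected) (hR : IsBlock G R)
    {P' : Finset V} {c' : V} (h' : IsChild G R C P' c') : c' = c := by
  by_contra hne
  have h1 := h.separates_child.rootDist_lt hconn hR.nonempty h'.mem_child hne
  have h2 := h'.separates_child.rootDist_lt hconn hR.nonempty h.mem_child (Ne.symm hne)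
  omega

/-- The largest distance of a vertex of `B` from the root block. -/
noncomputable def blockRank (G : SimpleGraph V) (R B : Finset V) : ℕ := B.sup (rootDist G R)

/-- No vertex of `P` is farther from the root than `c`. For `P ≠ R` with its own cut vertex `b`, one
has `c ≠ b`, so `c` is strictly farther than `b`, while the clique `P` lies within distance one of
`b`. Every vertex of `C` other than `c` is farther than `c`. -/
lemma IsChild.blockRank_lt [Finite V] (h : IsChild G R C P c) (hconn : G.Connected)
    (hG : IsBlockGraph G) (hR : IsBlock G R) : blockRank G R P < blockRank G R C := by
  have hP : blockRank G R P ≤ rootDist G R c := by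
    refine Finset.sup_le fun x hx => ?_
    by_cases hPR : P = R
    · subst hPR; simp [rootDist_eq_zero hx]
    obtain ⟨Q, b, hb⟩ := exists_isChild hconn hG hR h.block_parent hPR
    have hbc : c ≠ b := by
      rintro rfl
      exact h.not_separates_parent hb.separates_child
    by_contra! hlt
    have hxc : x ≠ c := by rintro rfl; omega
    have h1 := hb.separates_child.rootDist_lt hconn hR.nonempty h.mem_parent hbc
    have h2 : rootDist G R x ≤ rootDist G R b + 1 := by
      obtain ⟨z, hz, p, hp⟩ := exists_walk_length_eq_rootDist hconn hR.nonempty b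
      have hxb : x ≠ b := by rintro rfl; omega
      have := rootDist_le hz (p.cons (hG P h.block_parent hx hb.mem_child hxb))
      rw [SimpleGraph.Walk.length_cons] at this
      omega
    omega
  obtain ⟨y, hy, hyc⟩ := h.block_child.exists_mem_ne h.block_parent h.ne h.mem_parent
  have h1 := h.separates_child.rootDist_lt hconn hR.nonempty hy hyc
  have h2 : rootDist G R y ≤ blockRank G R C := Finset.le_sup hy
  omega

lemma exists_isBlock_of_mem [Finite V] (x : V) : ∃ B, IsBlock G B ∧ x ∈ B := by
  obtain ⟨B, hB, hs⟩ := exists_isBlock_of_isClique (G := G) (S := {x}) (by simp) (by simp)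
  exact ⟨B, hB, hs (by simp)⟩

lemma IsChild.adj_of_mem (h : IsChild G R C P c) (hG : IsBlockGraph G) {x : V}
    (hx : x ∈ C ∨ x ∈ P) (hxc : x ≠ c) : G.Adj c x := by
  rcases hx with hx | hx
  · exact hG C h.block_child h.mem_child hx hxc.symm
  · exact hG P h.block_parent h.mem_parent hx hxc.symm

lemma IsChild.card_add_card [Fintype V] [DecidableRel G.Adj] [DecidableEq V] (h : IsChild G R C P c) (hG : IsBlockGraph G)
    (hclaw : IsClawFree G) : C.card + P.card = G.degree c + 2 := by
  have hN : G.neighborFinset c = C.erase c ∪ P.erase c := by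
    ext x
    simp only [SimpleGraph.mem_neighborFinset, Finset.mem_union, Finset.mem_erase]
    constructor
    · intro hadj
      obtain ⟨B, hB, hcB, hxB⟩ := exists_isBlock_of_adj hadj
      rcases hclaw.block_eq_or_eq hG h.block_child h.block_parent hB h.mem_child h.mem_parent hcB
        h.ne with rfl | rfl
      · exact .inl ⟨hadj.ne', hxB⟩
      · exact .inr ⟨hadj.ne', hxB⟩
    · rintro (⟨hne, hx⟩ | ⟨hne, hx⟩)
      · exact h.adj_of_mem hG (.inl hx) hne
      · exact h.adj_of_mem hG (.inr hx) hne
  have hd : Disjoint (C.erase c) (P.erase c) := by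
    rw [Finset.disjoint_left]
    intro x hx hx'
    exact (Finset.mem_erase.mp hx).1
      (h.eq_of_mem_of_mem hG (Finset.mem_erase.mp hx).2 (Finset.mem_erase.mp hx').2)
  rw [← SimpleGraph.card_neighborFinset_eq_degree, hN, Finset.card_union_of_disjoint hd,
    Finset.card_erase_of_mem h.mem_child, Finset.card_erase_of_mem h.mem_parent]
  have := Finset.card_pos.mpr ⟨c, h.mem_child⟩
  have := Finset.card_pos.mpr ⟨c, h.mem_parent⟩
  omega

lemma IsBlockGraph.card_lt [Finite V] (hG : IsBlockGraph G) {k : ℕ} (hk : G.cliqueNum < k) {B : Finset V}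
    (hB : IsBlock G B) : B.card < k :=
  (SimpleGraph.IsClique.card_le_cliqueNum (tc := hG B hB)).trans_lt hk

/-- A vertex in a single block `B` has degree at most `|B| - 1 < k - 1`. -/
lemma exists_isChild_of_mem_denseSet [Fintype V] [DecidableRel G.Adj] [DecidableEq V]
    (hconn : G.Connected) (hG : IsBlockGraph G)
    (hR : IsBlock G R) {k : ℕ} (hk : G.cliqueNum < k) {w : V} (hw : w ∈ denseSet G k) :
    ∃ C P, IsChild G R C P w := by
  obtain ⟨B, hB, hwB⟩ := exists_isBlock_of_mem (G := G) w
  by_cases h : ∃ B', IsBlock G B' ∧ w ∈ B' ∧ B ≠ B'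
  · obtain ⟨B', hB', hwB', hne⟩ := h
    exact exists_isChild_of_mem_of_mem hconn hG hR hB hB' hne hwB hwB'
  · push Not at h
    exfalso
    have hsub : G.neighborFinset w ⊆ B.erase w := by
      intro x hx
      rw [SimpleGraph.mem_neighborFinset] at hx
      obtain ⟨B', hB', hwB', hxB'⟩ := exists_isBlock_of_adj hx
      exact Finset.mem_erase.mpr ⟨hx.ne', h B' hB' hwB' ▸ hxB'⟩
    have h1 := Finset.card_le_card hsub
    rw [SimpleGraph.card_neighborFinset_eq_degree, Finset.card_erase_of_mem hwB] at h1
    have h2 := hG.card_lt hk hB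
    have h3 := Finset.card_pos.mpr ⟨w, hwB⟩
    have h4 : k ≤ G.degree w + 1 := hw
    omega

end RootedBlockGraphs

/-! ### Acyclicity of the network -/

section Ranks

variable {V : Type*} [Fintype V] {G : SimpleGraph V} {R W : Finset V}

/-- A rank of the nodes of the flow network that decreases along the arcs. -/
noncomputable def nodeRank (G : SimpleGraph V) (R : Finset V) : Node V → ℕ
  | .vert B _ => 2 * blockRank G R B
  | .cash B => 2 * blockRank G R B
  | .link _ P _ => 2 * blockRank G R P + 1
  | .source _ => 2 * blockRank G R Finset.univ + 1

/-- Doubling the block ranks leaves an odd value for a link, strictly between parent and child;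
sources lie above every block. -/
lemma FlowArc.nodeRank_lt (hconn : G.Connected) (hG : IsBlockGraph G) (hR : IsBlock G R)
    {γ δ : Node V} (h : FlowArc G R W γ δ) : nodeRank G R δ < nodeRank G R γ := by
  cases h with
  | @source_vert C _ _ _ _ =>
    have : blockRank G R C ≤ blockRank G R Finset.univ := Finset.sup_mono (Finset.subset_univ _)
    simp only [nodeRank]
    exact Nat.lt_succ_of_le (Nat.mul_le_mul_left 2 this)
  | vert_vert h | vert_link h | link_vert h | cash_link h | link_cash h | vert_cash h
  | cash_vert h =>
    have := h.blockRank_lt hconn hG hR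
    simp only [nodeRank]
    omega

lemma pairwise_nodeRank_of_isChain (hconn : G.Connected) (hG : IsBlockGraph G) (hR : IsBlock G R)
    {l : List (Node V)} (h : l.IsChain (FlowArc G R W)) :
    l.Pairwise fun γ δ => nodeRank G R δ < nodeRank G R γ := by
  have : IsTrans (Node V) fun γ δ => nodeRank G R δ < nodeRank G R γ :=
    ⟨fun _ _ _ h1 h2 => lt_trans h2 h1⟩
  exact (h.imp fun _ _ h => h.nodeRank_lt hconn hG hR).pairwise

lemma nodup_of_isChain (hconn : G.Connected) (hG : IsBlockGraph G) (hR : IsBlock G R)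
    {l : List (Node V)} (h : l.IsChain (FlowArc G R W)) : l.Nodup :=
  (pairwise_nodeRank_of_isChain hconn hG hR h).imp fun h1 h2 => by rw [h2] at h1; omega

/-- The nodes `B_x` and `(B)` of one block share a rank, so a path uses at most one of them. -/
lemma eq_of_nodeRank_eq (hconn : G.Connected) (hG : IsBlockGraph G) (hR : IsBlock G R)
    {l : List (Node V)} (h : l.IsChain (FlowArc G R W)) {γ δ : Node V} (hγ : γ ∈ l) (hδ : δ ∈ l)
    (heq : nodeRank G R γ = nodeRank G R δ) : γ = δ := by
  have h1 := pairwise_nodeRank_of_isChain hconn hG hR h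
  exact List.Pairwise.forall_of_forall_of_flip (R := fun γ δ =>
    nodeRank G R γ = nodeRank G R δ → γ = δ) (fun _ _ _ => rfl)
    (h1.imp fun h h' => absurd h' h.ne') (h1.imp fun h h' => absurd h' h.ne) hγ hδ heq

lemma exists_mem_of_isChain {N : Type*} {r : N → N → Prop} {l : List N} (h : l.IsChain r)
    {γ : N} (hγ : γ ∈ l) : l.getLast? = some γ ∨ ∃ δ ∈ l, r γ δ := by
  induction l with
  | nil => simp at hγ
  | cons a l ih =>
    cases l with
    | nil => left; simp_all
    | cons b l =>
      rw [List.isChain_cons_cons] at h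
      rcases List.mem_cons.mp hγ with rfl | hγ
      · exact .inr ⟨b, by simp, h.1⟩
      · rcases ih h.2 hγ with h' | ⟨δ, hδ, hr⟩
        · left; simpa using h'
        · exact .inr ⟨δ, List.mem_cons_of_mem _ hδ, hr⟩

end Ranks

/-! ### Uniqueness of the parent -/

section RootedBlockGraphs

variable {V : Type*} {G : SimpleGraph V} {R C P : Finset V} {c : V}

lemma IsChild.parent_eq [Finite V] (h : IsChild G R C P c) (hconn : G.Connected)
    (hG : IsBlockGraph G) (hclaw : IsClawFree G) (hR : IsBlock G R) {P' : Finset V} {c' : V}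
    (h' : IsChild G R C P' c') : P' = P ∧ c' = c := by
  obtain rfl := h.cutVertex_eq hconn hR h'
  exact ⟨(h.blocks_eq hG hclaw h').2, rfl⟩

end RootedBlockGraphs

/-! ### How a path of a flow continues from a block to its parent -/

section Flows

variable {V : Type*} [Fintype V] [DecidableEq V] {G : SimpleGraph V} [DecidableRel G.Adj]
  {R W : Finset V} {k : ℕ} {f : W → List (Node V)}

lemma IsFlow.isNode (hf : IsFlow (flowNetwork G R k W) f) {w : W} {γ : Node V} (h : γ ∈ f w) :
    IsNode G R W γ :=
  (hf.1 w).1.2.1 γ h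

lemma IsFlow.isChain (hf : IsFlow (flowNetwork G R k W) f) (w : W) :
    (f w).IsChain (FlowArc G R W) :=
  (hf.1 w).1.2.2.1

lemma IsFlow.source_mem (hf : IsFlow (flowNetwork G R k W) f) (w : W) : .source (w : V) ∈ f w :=
  List.mem_of_mem_head? (hf.1 w).2.1

lemma IsFlow.card_le (hf : IsFlow (flowNetwork G R k W) f) {γ : Node V}
    (hγ : ∀ x, γ ≠ .source x) {A : Finset W} (hA : ∀ w ∈ A, γ ∈ f w) :
    A.card ≤ nodeCap G k W γ := by
  rcases A.eq_empty_or_nonempty with rfl | ⟨w, hw⟩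
  · simp
  · rw [← Set.ncard_coe_finset]
    exact (Set.ncard_le_ncard hA (Set.toFinite _)).trans
      (hf.2 γ (hf.isNode (hA w hw)) fun h => by
        obtain ⟨x, hx⟩ := h.2
        exact hγ x hx)

lemma IsFlow.eq_of_vert_mem (hf : IsFlow (flowNetwork G R k W) f) {B : Finset V} {x : V}
    {w w' : W} (h : .vert B x ∈ f w) (h' : .vert B x ∈ f w') : w = w' := by
  by_contra hne
  have := hf.card_le (γ := .vert B x) (by simp) (A := {w, w'}) (by simp [h, h'])
  rw [Finset.card_pair hne] at this
  simp [nodeCap] at this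

lemma IsFlow.exists_arc (hf : IsFlow (flowNetwork G R k W) f) {w : W} {γ : Node V} (h : γ ∈ f w)
    (hγ : ∀ t, t = .cash R ∨ (∃ x ∈ R, t = .vert R x) → γ ≠ t) :
    ∃ δ ∈ f w, FlowArc G R W γ δ := by
  refine (exists_mem_of_isChain (hf.isChain w) h).resolve_left fun hlast => ?_
  obtain ⟨t, ht, hlast'⟩ := (hf.1 w).2.2
  exact hγ t ht (Option.some_injective _ (hlast.symm.trans hlast'))

variable {C P : Finset V} {c : V}

lemma IsFlow.vert_mem_parent (hf : IsFlow (flowNetwork G R k W) f) (hconn : G.Connected)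
    (hG : IsBlockGraph G) (hclaw : IsClawFree G) (hR : IsBlock G R) (h : IsChild G R C P c)
    {w : W} (hw : .vert C c ∈ f w) : .vert P c ∈ f w := by
  obtain ⟨δ, hδ, harc⟩ := hf.exists_arc hw (by
    rintro t (rfl | ⟨x, hx, rfl⟩) <;> simp [h.child_ne_root])
  cases harc with
  | vert_vert h' => exact (h.parent_eq hconn hG hclaw hR h').1 ▸ hδ
  | vert_link h' hx hne => exact (hne (h.parent_eq hconn hG hclaw hR h').2.symm).elim
  | vert_cash h' hc hx hne => exact (hne (h.parent_eq hconn hG hclaw hR h').2.symm).elim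

lemma IsFlow.link_mem_or_cash_mem (hf : IsFlow (flowNetwork G R k W) f) (hconn : G.Connected)
    (hG : IsBlockGraph G) (hclaw : IsClawFree G) (hR : IsBlock G R) (h : IsChild G R C P c)
    {w : W} {x : V} (hxc : x ≠ c) (hw : .vert C x ∈ f w) :
    .link C P c ∈ f w ∨ .cash P ∈ f w := by
  obtain ⟨δ, hδ, harc⟩ := hf.exists_arc hw (by
    rintro t (rfl | ⟨x, hx, rfl⟩) <;> simp [h.child_ne_root])
  cases harc with
  | vert_vert h' => exact (hxc (h.parent_eq hconn hG hclaw hR h').2).elim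
  | vert_link h' hx hne =>
    obtain ⟨rfl, rfl⟩ := h.parent_eq hconn hG hclaw hR h'
    exact .inl hδ
  | vert_cash h' hc hx hne =>
    obtain ⟨rfl, rfl⟩ := h.parent_eq hconn hG hclaw hR h'
    exact .inr hδ

lemma IsFlow.exists_of_link_mem (hf : IsFlow (flowNetwork G R k W) f) {w : W}
    (hw : .link C P c ∈ f w) : (∃ x ∈ P, x ≠ c ∧ .vert P x ∈ f w) ∨ .cash P ∈ f w := by
  obtain ⟨δ, hδ, harc⟩ := hf.exists_arc hw (by rintro t (rfl | ⟨x, hx, rfl⟩) <;> simp)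
  cases harc with
  | link_vert h' hx hne => exact .inl ⟨_, hx, hne, hδ⟩
  | link_cash h' hc => exact .inr hδ

lemma IsFlow.exists_of_cash_mem (hf : IsFlow (flowNetwork G R k W) f) (hconn : G.Connected)
    (hG : IsBlockGraph G) (hclaw : IsClawFree G) (hR : IsBlock G R) (h : IsChild G R C P c)
    {w : W} (hw : .cash C ∈ f w) :
    (c ∉ W ∧ .link C P c ∈ f w) ∨ ∃ x ∈ P, x ≠ c ∧ .vert P x ∈ f w := by
  obtain ⟨δ, hδ, harc⟩ := hf.exists_arc hw (by
    rintro t (rfl | ⟨x, hx, rfl⟩) <;> simp [h.child_ne_root])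
  cases harc with
  | cash_link h' hc =>
    obtain ⟨rfl, rfl⟩ := h.parent_eq hconn hG hclaw hR h'
    exact .inl ⟨hc, hδ⟩
  | cash_vert h' hc hx hne =>
    obtain ⟨rfl, rfl⟩ := h.parent_eq hconn hG hclaw hR h'
    exact .inr ⟨_, hx, hne, hδ⟩

lemma IsFlow.vert_mem_of_source_mem (hf : IsFlow (flowNetwork G R k W) f) (hG : IsBlockGraph G)
    (hclaw : IsClawFree G) (h : IsChild G R C P c) {w : W} (hw : .source c ∈ f w) :
    .vert C c ∈ f w := by
  obtain ⟨δ, hδ, harc⟩ := hf.exists_arc hw (by rintro t (rfl | ⟨x, hx, rfl⟩) <;> simp)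
  cases harc with
  | source_vert h' hc => exact (h.blocks_eq hG hclaw h').1 ▸ hδ

/-- This keeps the color of `c`, already chosen in `P`, apart from every color that the flow imposes
on `C \ {c}` or sends through `(C)`. -/
lemma IsFlow.exists_parent_of_mem (hf : IsFlow (flowNetwork G R k W) f) (hconn : G.Connected)
    (hG : IsBlockGraph G) (hclaw : IsClawFree G) (hR : IsBlock G R) (h : IsChild G R C P c)
    {w : W} (hw : (∃ x, x ≠ c ∧ .vert C x ∈ f w) ∨ .cash C ∈ f w) :
    (∃ x ∈ P, x ≠ c ∧ .vert P x ∈ f w) ∨ .cash P ∈ f w := by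
  rcases hw with ⟨x, hx, hw⟩ | hw
  · rcases hf.link_mem_or_cash_mem hconn hG hclaw hR h hx hw with h' | h'
    · exact hf.exists_of_link_mem h'
    · exact .inr h'
  · rcases hf.exists_of_cash_mem hconn hG hclaw hR h hw with ⟨-, h'⟩ | h'
    · exact hf.exists_of_link_mem h'
    · exact .inl h'

lemma IsFlow.eq_of_vert_mem_of_vert_mem (hf : IsFlow (flowNetwork G R k W) f)
    (hconn : G.Connected) (hG : IsBlockGraph G) (hR : IsBlock G R) {w : W} {B : Finset V}
    {x y : V} (hx : .vert B x ∈ f w) (hy : .vert B y ∈ f w) : x = y := by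
  simpa using eq_of_nodeRank_eq hconn hG hR (hf.isChain w) hx hy rfl

lemma IsFlow.vert_notMem_of_cash_mem (hf : IsFlow (flowNetwork G R k W) f)
    (hconn : G.Connected) (hG : IsBlockGraph G) (hR : IsBlock G R) {w : W} {B : Finset V}
    {x : V} (hB : .cash B ∈ f w) : .vert B x ∉ f w := fun h => by
  simpa using eq_of_nodeRank_eq hconn hG hR (hf.isChain w) h hB rfl

end Flows

/-! ### Extending a coloring over one block -/

section Extension

lemma exists_injOn_and_subset_image {α κ : Type*} [DecidableEq κ] (g₀ : α → κ) {U : Finset α}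
    {M F : Finset κ} (hMF : M ⊆ F) (hMU : M.card ≤ U.card) (hUF : U.card ≤ F.card) :
    ∃ g : α → κ, Set.InjOn g U ∧ (∀ x ∈ U, g x ∈ F) ∧ ∀ m ∈ M, ∃ x ∈ U, g x = m := by
  classical
  obtain ⟨T, hMT, hTF, hT⟩ := Finset.exists_subsuperset_card_eq hMF hMU hUF
  let e : U ≃ T := Finset.equivOfCardEq hT.symm
  refine ⟨fun x => if h : x ∈ U then e ⟨x, h⟩ else g₀ x, ?_, ?_, ?_⟩
  · intro x hx y hy hxy
    have hx' : x ∈ U := hx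
    have hy' : y ∈ U := hy
    simpa [hx', hy'] using hxy
  · intro x hx
    simp only [hx, dif_pos]
    exact hTF (e ⟨x, hx⟩).2
  · intro m hm
    refine ⟨e.symm ⟨m, hMT hm⟩, (e.symm ⟨m, hMT hm⟩).2, ?_⟩
    simp

variable {V : Type*} {W : Finset V} {k : ℕ} {f : W → List (Node V)}

/-- In the block `B`, the coloring `ψ` is injective, each vertex `x` for which a path of `f` uses
the node `B_x` has the index of that path as its color, and the index of a path that uses the
cash-node `(B)` is not a color of a vertex of `B`. -/
structure RespectsOn (index : W ↪ Fin k) (f : W → List (Node V)) (ψ : V → Fin k)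
    (B : Finset V) : Prop where
  injOn : Set.InjOn ψ B
  eq_of_vert_mem : ∀ w, ∀ x ∈ B, Node.vert B x ∈ f w → ψ x = index w
  ne_of_cash_mem : ∀ w, Node.cash B ∈ f w → ∀ x ∈ B, ψ x ≠ index w

lemma RespectsOn.congr {index : W ↪ Fin k} {ψ ψ' : V → Fin k} {B : Finset V}
    (h : RespectsOn index f ψ B) (heq : ∀ x ∈ B, ψ' x = ψ x) : RespectsOn index f ψ' B where
  injOn := h.injOn.congr fun x hx => (heq x hx).symm
  eq_of_vert_mem w x hx hw := (heq x hx).trans (h.eq_of_vert_mem w x hx hw)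
  ne_of_cash_mem w hw x hx := by
    rw [heq x hx]
    exact h.ne_of_cash_mem w hw x hx

variable [Fintype V] [DecidableEq V] {G : SimpleGraph V} [DecidableRel G.Adj]
  {R : Finset V}

/-- Here `O` is the colored part of the block and `S` the part to be colored. Vertices of `S` on a
path take its index; the others, `U`, receive distinct colors from the free set `F`, chosen so as to
exhaust the prescribed colors `M`. -/
lemma IsFlow.exists_respectsOn (hf : IsFlow (flowNetwork G R k W) f) (hconn : G.Connected)
    (hG : IsBlockGraph G) (hR : IsBlock G R) (index : W ↪ Fin k) {B S O : Finset V}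
    (hBk : B.card ≤ k) (hSO : S ∪ O = B) (hdisj : Disjoint S O) {ψ : V → Fin k}
    (hinj : Set.InjOn ψ O) (hvert : ∀ w, ∀ x ∈ O, .vert B x ∈ f w → ψ x = index w)
    (hvertS : ∀ w, ∀ x ∈ S, .vert B x ∈ f w → ∀ y ∈ O, ψ y ≠ index w)
    (hcash : ∀ w, .cash B ∈ f w → ∀ y ∈ O, ψ y ≠ index w)
    {M : Finset (Fin k)} (hMO : ∀ y ∈ O, ψ y ∉ M)
    (hMS : ∀ w, ∀ x ∈ S, .vert B x ∈ f w → index w ∉ M)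
    (hMc : ∀ w, .cash B ∈ f w → index w ∉ M)
    {A : Finset W} (hA : ∀ w, w ∈ A ↔ ∃ x ∈ S, .vert B x ∈ f w)
    (hMA : M.card + A.card ≤ S.card) :
    ∃ ψ' : V → Fin k, (∀ x ∉ S, ψ' x = ψ x) ∧ RespectsOn index f ψ' B ∧
      ∀ m ∈ M, ∃ x ∈ S, ψ' x = m := by
  classical
  set sat := S.filter fun x => ∃ w, .vert B x ∈ f w with hsat
  set U := S.filter fun x => ¬ ∃ w, .vert B x ∈ f w with hU
  have hsatU : sat.card + U.card = S.card := Finset.card_filter_add_card_filter_not _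
  -- Vertices of `S` met by paths and paths meeting `S` correspond bijectively: `B_x` has capacity
  -- one, and a path uses at most one node `B_x`.
  have hsatA : sat.card = A.card := by
    refine Finset.card_bij (fun x hx => (Finset.mem_filter.mp hx).2.choose) ?_ ?_ ?_
    · intro x hx
      exact (hA _).2 ⟨x, (Finset.mem_filter.mp hx).1, (Finset.mem_filter.mp hx).2.choose_spec⟩
    · intro x hx y hy hxy
      have hy' := (Finset.mem_filter.mp hy).2.choose_spec
      rw [← hxy] at hy'
      exact hf.eq_of_vert_mem_of_vert_mem hconn hG hR (Finset.mem_filter.mp hx).2.choose_spec hy'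
    · intro w hw
      obtain ⟨x, hx, hxw⟩ := (hA w).1 hw
      have hx' : x ∈ sat := Finset.mem_filter.mpr ⟨hx, w, hxw⟩
      exact ⟨x, hx', hf.eq_of_vert_mem (Finset.mem_filter.mp hx').2.choose_spec hxw⟩
  set cashed : Finset W := Finset.univ.filter fun w => .cash B ∈ f w with hcashed
  have hcard : cashed.card ≤ k - B.card := hf.card_le (γ := .cash B) (by simp) (by simp [hcashed])
  set F : Finset (Fin k) := (O.image ψ ∪ A.image index ∪ cashed.image index)ᶜ with hF
  have hFO : ∀ m ∈ F, ∀ y ∈ O, ψ y ≠ m := by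
    rintro _ hm y hy rfl
    simp only [hF, Finset.mem_compl, Finset.mem_union, not_or] at hm
    exact hm.1.1 (Finset.mem_image_of_mem _ hy)
  have hFA : ∀ m ∈ F, ∀ w, ∀ x ∈ S, .vert B x ∈ f w → index w ≠ m := by
    rintro _ hm w x hx hw rfl
    simp only [hF, Finset.mem_compl, Finset.mem_union, not_or] at hm
    exact hm.1.2 (Finset.mem_image_of_mem _ ((hA w).2 ⟨x, hx, hw⟩))
  have hFc : ∀ m ∈ F, ∀ w, .cash B ∈ f w → index w ≠ m := by
    rintro _ hm w hw rfl
    simp only [hF, Finset.mem_compl, Finset.mem_union, not_or] at hm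
    exact hm.2 (Finset.mem_image_of_mem _ (by simpa [hcashed] using hw))
  have hMF : M ⊆ F := by
    intro m hm
    simp only [hF, Finset.mem_compl, Finset.mem_union, Finset.mem_image, not_or, not_exists,
      not_and]
    refine ⟨⟨fun y hy h => hMO y hy (h ▸ hm), fun w hw h => ?_⟩, fun w hw h => ?_⟩
    · obtain ⟨x, hx, hxw⟩ := (hA w).1 hw
      exact hMS w x hx hxw (h ▸ hm)
    · exact hMc w (by simpa [hcashed] using hw) (h ▸ hm)
  -- At most `k - |B|` paths use `(B)`, so `|F| ≥ k - |O| - |A| - (k - |B|) = |S| - |A| = |U|`.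
  have hUF : U.card ≤ F.card := by
    have h1 : (O.image ψ ∪ A.image index ∪ cashed.image index).card
        ≤ O.card + A.card + cashed.card :=
      (Finset.card_union_le _ _).trans (add_le_add ((Finset.card_union_le _ _).trans
        (add_le_add Finset.card_image_le Finset.card_image_le)) Finset.card_image_le)
    have h2 : S.card + O.card = B.card := by rw [← hSO, Finset.card_union_of_disjoint hdisj]
    rw [hF, Finset.card_compl, Fintype.card_fin]
    omega
  obtain ⟨g, hg, hgF, hgM⟩ := exists_injOn_and_subset_image ψ hMF (U := U) (by omega) hUF
  set ψ' : V → Fin k := fun x => if x ∈ S then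
    (if h : ∃ w, .vert B x ∈ f w then index h.choose else g x) else ψ x with hψ'
  have hoff : ∀ x ∉ S, ψ' x = ψ x := fun x hx => by simp [hψ', hx]
  have hon : ∀ w, ∀ x ∈ S, .vert B x ∈ f w → ψ' x = index w := by
    intro w x hx hw
    have h : ∃ w, .vert B x ∈ f w := ⟨w, hw⟩
    simp only [hψ', hx, if_true, dif_pos h]
    rw [hf.eq_of_vert_mem h.choose_spec hw]
  have hUS : ∀ x ∈ U, ψ' x = g x := by
    intro x hx
    simp only [hψ', (Finset.mem_filter.mp hx).1, if_true, dif_neg (Finset.mem_filter.mp hx).2]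
  have hUFx : ∀ x ∈ U, ψ' x ∈ F := fun x hx => hUS x hx ▸ hgF x hx
  have hO : ∀ x ∈ O, ψ' x = ψ x := fun x hx => hoff x fun h =>
    Finset.disjoint_left.mp hdisj h hx
  have hcases : ∀ x ∈ B, x ∈ O ∨ (x ∈ S ∧ ∃ w, .vert B x ∈ f w) ∨ x ∈ U := by
    intro x hx
    rw [← hSO, Finset.mem_union] at hx
    by_cases h : ∃ w, .vert B x ∈ f w <;> simp only [hU, Finset.mem_filter] <;> tauto
  refine ⟨ψ', hoff, ⟨?_, ?_, ?_⟩, ?_⟩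
  · intro x hx y hy hxy
    rcases hcases x hx with hx | ⟨hx, w, hw⟩ | hx <;>
    rcases hcases y hy with hy | ⟨hy, v, hv⟩ | hy
    · rw [hO x hx, hO y hy] at hxy
      exact hinj hx hy hxy
    · rw [hO x hx, hon v y hy hv] at hxy
      exact (hvertS v y hy hv x hx hxy).elim
    · rw [hO x hx] at hxy
      exact (hFO _ (hUFx y hy) x hx hxy).elim
    · rw [hO y hy, hon w x hx hw] at hxy
      exact (hvertS w x hx hw y hy hxy.symm).elim
    · rw [hon w x hx hw, hon v y hy hv] at hxy
      obtain rfl := index.injective hxy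
      exact hf.eq_of_vert_mem_of_vert_mem hconn hG hR hw hv
    · rw [hon w x hx hw] at hxy
      exact (hFA _ (hUFx y hy) w x hx hw hxy).elim
    · rw [hO y hy] at hxy
      exact (hFO _ (hUFx x hx) y hy hxy.symm).elim
    · rw [hon v y hy hv] at hxy
      exact (hFA _ (hUFx x hx) v y hy hv hxy.symm).elim
    · rw [hUS x hx, hUS y hy] at hxy
      exact hg hx hy hxy
  · intro w x hx hw
    rw [← hSO, Finset.mem_union] at hx
    rcases hx with hx | hx
    · exact hon w x hx hw
    · rw [hO x hx]
      exact hvert w x hx hw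
  · intro w hw x hx heq
    rcases hcases x hx with hx | ⟨hx, v, hv⟩ | hx
    · rw [hO x hx] at heq
      exact hcash w hw x hx heq
    · rw [hon v x hx hv] at heq
      obtain rfl := index.injective heq
      exact hf.vert_notMem_of_cash_mem hconn hG hR hw hv
    · exact hFc _ (hUFx x hx) w hw heq.symm
  · intro m hm
    obtain ⟨x, hx, hgx⟩ := hgM m hm
    exact ⟨x, (Finset.mem_filter.mp hx).1, (hUS x hx).trans hgx⟩

end Extension

/-! ### From a flow to a coloring -/

section FlowColorings

variable {V : Type*} [Fintype V] [DecidableEq V] {G : SimpleGraph V} [DecidableRel G.Adj]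
  {R W : Finset V} {k : ℕ} {f : W → List (Node V)} {C P : Finset V} {c : V}

lemma IsFlow.card_le_of_vert_mem (hf : IsFlow (flowNetwork G R k W) f) {B S : Finset V}
    {A : Finset W} (hA : ∀ w ∈ A, ∃ x ∈ S, .vert B x ∈ f w) : A.card ≤ S.card := by
  choose p hp hpf using hA
  refine Finset.card_le_card_of_forall_subsingleton (fun w x => .vert B x ∈ f w)
    (fun w hw => ⟨p w hw, hp w hw, hpf w hw⟩) fun x _ w hw v hv => ?_
  exact hf.eq_of_vert_mem hw.2 hv.2

lemma IsFlow.exists_respectsOn_root (hf : IsFlow (flowNetwork G R k W) f) (hconn : G.Connected)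
    (hG : IsBlockGraph G) (hR : IsBlock G R) (hk : G.cliqueNum < k) (index : W ↪ Fin k)
    (ψ : V → Fin k) : ∃ ψ' : V → Fin k, RespectsOn index f ψ' R := by
  classical
  set A : Finset W := Finset.univ.filter fun w => ∃ x ∈ R, Node.vert R x ∈ f w with hA
  have hAR : A.card ≤ R.card := hf.card_le_of_vert_mem (B := R) (by simp [hA])
  obtain ⟨ψ', -, h, -⟩ := hf.exists_respectsOn hconn hG hR index (B := R) (S := R) (O := ∅)
    (hG.card_lt hk hR).le (by simp) (by simp) (ψ := ψ) (by simp) (by simp) (by simp) (by simp)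
    (M := ∅) (by simp) (by simp) (by simp) (A := A) (by simp [hA]) (by simpa using hAR)
  exact ⟨ψ', h⟩

lemma IsFlow.exists_respectsOn_child (hf : IsFlow (flowNetwork G R k W) f) (hconn : G.Connected)
    (hG : IsBlockGraph G) (hclaw : IsClawFree G) (hR : IsBlock G R) (hk : G.cliqueNum < k)
    (hW : (W : Set V) ⊆ denseSet G k) (index : W ↪ Fin k) (h : IsChild G R C P c)
    {ψ : V → Fin k} (hψ : RespectsOn index f ψ P) :
    ∃ ψ' : V → Fin k, (∀ x ∉ C.erase c, ψ' x = ψ x) ∧ RespectsOn index f ψ' C ∧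
      (c ∈ W → ∀ j, j ≠ ψ' c → ∃ v, (v ∈ C ∨ v ∈ P) ∧ v ≠ c ∧ ψ' v = j) := by
  classical
  set A : Finset W := Finset.univ.filter fun w => ∃ x ∈ C.erase c, Node.vert C x ∈ f w with hA
  have hA' : ∀ w, w ∈ A ↔ ∃ x ∈ C.erase c, Node.vert C x ∈ f w := by simp [hA]
  have hAC : A.card ≤ (C.erase c).card := hf.card_le_of_vert_mem fun w => (hA' w).1
  have hne : ∀ w, ((∃ x, x ≠ c ∧ .vert C x ∈ f w) ∨ .cash C ∈ f w) → ψ c ≠ index w := by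
    intro w hw heq
    rcases hf.exists_parent_of_mem hconn hG hclaw hR h hw with ⟨x, hx, hxc, hxw⟩ | hw'
    · exact hxc (hψ.injOn hx h.mem_parent ((hψ.eq_of_vert_mem w x hx hxw).trans heq.symm))
    · exact hψ.ne_of_cash_mem w hw' c h.mem_parent heq
  -- For `c ∈ W` these are the colors that neither `P` nor the paths through `C` supply; they have
  -- to be placed on `C \ {c}`.
  set M : Finset (Fin k) := if c ∈ W then
    (P.image ψ ∪ A.image index ∪ (Finset.univ.filter fun w => Node.cash C ∈ f w).image index)ᶜ
    else ∅ with hM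
  have hMP : ∀ y ∈ P, ψ y ∉ M := by
    intro y hy hm
    by_cases hcW : c ∈ W
    · simp only [hM, hcW, if_true, Finset.mem_compl, Finset.mem_union, not_or] at hm
      exact hm.1.1 (Finset.mem_image_of_mem _ hy)
    · simp [hM, hcW] at hm
  have hMS : ∀ w ∈ A, index w ∉ M := by
    intro w hw hm
    by_cases hcW : c ∈ W
    · simp only [hM, hcW, if_true, Finset.mem_compl, Finset.mem_union, not_or] at hm
      exact hm.1.2 (Finset.mem_image_of_mem _ hw)
    · simp [hM, hcW] at hm
  have hMc : ∀ w, .cash C ∈ f w → index w ∉ M := by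
    intro w hw hm
    by_cases hcW : c ∈ W
    · simp only [hM, hcW, if_true, Finset.mem_compl, Finset.mem_union, not_or] at hm
      exact hm.2 (Finset.mem_image_of_mem _ (by simpa using hw))
    · simp [hM, hcW] at hm
  -- For `c ∈ W`, a path in `A` goes on through `(C, P)` (at most `d(c) + 1 - k` paths) or through
  -- `(P)`. The indices of the latter and the colors in `M` are disjoint and both miss `P`, hence
  -- number at most `k - |P|` together. The sum is `d(c) + 1 - |P| = |C| - 1`.
  have hMA : M.card + A.card ≤ (C.erase c).card := by
    by_cases hcW : c ∈ W
    · set A₁ := A.filter fun w => Node.link C P c ∈ f w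
      set A₂ := A.filter fun w => Node.cash P ∈ f w with hA₂
      have h1 : A.card ≤ A₁.card + A₂.card := by
        refine (Finset.card_le_card fun w hw => ?_).trans (Finset.card_union_le _ _)
        obtain ⟨x, hx, hxw⟩ := (hA' w).1 hw
        simp only [A₁, A₂, Finset.mem_union, Finset.mem_filter]
        exact (hf.link_mem_or_cash_mem hconn hG hclaw hR h (Finset.mem_erase.mp hx).1 hxw).imp
          (fun h => ⟨hw, h⟩) fun h => ⟨hw, h⟩
      have h2 : A₁.card ≤ G.degree c + 1 - k := by
        simpa [nodeCap, hcW] using hf.card_le (γ := .link C P c) (by simp) (A := A₁)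
          (by simp [A₁])
      have h3 : M.card + A₂.card ≤ k - P.card := by
        have hdisj : Disjoint M (A₂.image index) := by
          rw [Finset.disjoint_right]
          intro j hj
          obtain ⟨w, hw, rfl⟩ := Finset.mem_image.mp hj
          exact hMS w (Finset.mem_filter.mp hw).1
        have hsub : M ∪ A₂.image index ⊆ (P.image ψ)ᶜ := by
          intro j hj
          rw [Finset.mem_compl]
          intro hjP
          obtain ⟨y, hy, rfl⟩ := Finset.mem_image.mp hjP
          rcases Finset.mem_union.mp hj with hj | hj
          · exact hMP y hy hj
          · obtain ⟨w, hw, hwy⟩ := Finset.mem_image.mp hj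
            exact hψ.ne_of_cash_mem w (Finset.mem_filter.mp hw).2 y hy hwy.symm
        have := Finset.card_le_card hsub
        rwa [Finset.card_union_of_disjoint hdisj, Finset.card_image_of_injective _ index.injective,
          Finset.card_compl, Fintype.card_fin, Finset.card_image_of_injOn hψ.injOn] at this
      have h4 : k ≤ G.degree c + 1 := hW hcW
      have h5 := h.card_add_card hG hclaw
      have h6 := hG.card_lt hk h.block_parent
      rw [Finset.card_erase_of_mem h.mem_child]
      omega
    · simpa [hM, hcW] using hAC
  obtain ⟨ψ', hoff, hres, hMψ⟩ := hf.exists_respectsOn hconn hG hR index (B := C)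
    (S := C.erase c) (O := {c}) (hG.card_lt hk h.block_child).le
    (by
      ext x
      by_cases hx : x = c <;> simp [hx, h.mem_child])
    (by simp) (ψ := ψ) (by simp)
    (by
      simp only [Finset.mem_singleton]
      rintro w x rfl hw
      exact hψ.eq_of_vert_mem w x h.mem_parent (hf.vert_mem_parent hconn hG hclaw hR h hw))
    (by
      simp only [Finset.mem_singleton]
      rintro w x hx hw y rfl
      exact hne w (.inl ⟨x, (Finset.mem_erase.mp hx).1, hw⟩))
    (by
      simp only [Finset.mem_singleton]
      rintro w hw y rfl
      exact hne w (.inr hw))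
    (M := M) (by simpa using hMP c h.mem_parent)
    (fun w x hx hw => hMS w ((hA' w).2 ⟨x, hx, hw⟩)) hMc hA' hMA
  refine ⟨ψ', hoff, hres, fun hcW j hj => ?_⟩
  have hP : ∀ y ∈ P, ψ' y = ψ y := fun y hy => hoff y fun hy' =>
    (Finset.mem_erase.mp hy').1 (h.eq_of_mem_of_mem hG (Finset.mem_erase.mp hy').2 hy)
  by_cases hjM : j ∈ M
  · obtain ⟨x, hx, hxj⟩ := hMψ j hjM
    exact ⟨x, .inl (Finset.mem_erase.mp hx).2, (Finset.mem_erase.mp hx).1, hxj⟩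
  · have hvP : ∀ y ∈ P, ψ' y = j → ∃ v, (v ∈ C ∨ v ∈ P) ∧ v ≠ c ∧ ψ' v = j := by
      rintro y hy rfl
      exact ⟨y, .inr hy, fun hyc => hj (by rw [hyc]), rfl⟩
    -- A color outside `M` occurs on `P`, or is carried by a path through `C \ {c}`, or by a path
    -- through `(C)`; since `c ∈ W`, the last kind continues to some `P_x` with `x ≠ c`.
    simp only [hM, hcW, if_true, Finset.mem_compl, Finset.mem_union, not_not] at hjM
    rcases hjM with (hj' | hj') | hj'
    · obtain ⟨y, hy, rfl⟩ := Finset.mem_image.mp hj'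
      exact hvP y hy (hP y hy)
    · obtain ⟨w, hw, rfl⟩ := Finset.mem_image.mp hj'
      obtain ⟨x, hx, hxw⟩ := (hA' w).1 hw
      have hxC := (Finset.mem_erase.mp hx).2
      exact ⟨x, .inl hxC, (Finset.mem_erase.mp hx).1, hres.eq_of_vert_mem w x hxC hxw⟩
    · obtain ⟨w, hw, rfl⟩ := Finset.mem_image.mp hj'
      rcases hf.exists_of_cash_mem hconn hG hclaw hR h (by simpa using hw) with
        ⟨h', -⟩ | ⟨x, hx, hxc, hxw⟩
      · exact (h' hcW).elim
      · exact hvP x hx ((hP x hx).trans (hψ.eq_of_vert_mem w x hx hxw))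

/-- Induction over families of blocks closed under taking parents, a block of largest rank being
added last. -/
lemma IsFlow.exists_respectsOn_of_closed (hf : IsFlow (flowNetwork G R k W) f)
    (hconn : G.Connected) (hG : IsBlockGraph G) (hclaw : IsClawFree G) (hR : IsBlock G R)
    (hk : G.cliqueNum < k) (hW : (W : Set V) ⊆ denseSet G k) (index : W ↪ Fin k)
    (s : Finset (Finset V)) (hs : ∀ B ∈ s, IsBlock G B)
    (hclosed : ∀ C ∈ s, ∀ P c, IsChild G R C P c → P ∈ s) :
    ∃ ψ : V → Fin k, (∀ B ∈ s, RespectsOn index f ψ B) ∧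
      ∀ C ∈ s, ∀ P c, IsChild G R C P c → c ∈ W →
        ∀ j, j ≠ ψ c → ∃ v, (v ∈ C ∨ v ∈ P) ∧ v ≠ c ∧ ψ v = j := by
  induction s using Finset.induction_on_max_value (blockRank G R) with
  | empty => exact ⟨fun _ => ⟨0, by omega⟩, by simp, by simp⟩
  | insert B s hBs hmax ih =>
    have hclosed' : ∀ C ∈ s, ∀ P c, IsChild G R C P c → P ∈ s := by
      intro C hC P c h
      refine (Finset.mem_insert.mp (hclosed C (Finset.mem_insert_of_mem hC) P c h)).resolve_left ?_
      rintro rfl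
      have := h.blockRank_lt hconn hG hR
      have := hmax C hC
      omega
    obtain ⟨ψ, hψ, hcov⟩ := ih (fun C hC => hs C (Finset.mem_insert_of_mem hC)) hclosed'
    have hB : IsBlock G B := hs B (Finset.mem_insert_self _ _)
    by_cases hBR : B = R
    · subst hBR
      -- The root has rank zero and every other block has positive rank, so the root can be of
      -- largest rank only when it is alone.
      have hs0 : s = ∅ := by
        rw [Finset.eq_empty_iff_forall_notMem]
        intro C hC
        obtain ⟨P, c, h⟩ := exists_isChild hconn hG hR (hs C (Finset.mem_insert_of_mem hC))
          fun h => hBs (h ▸ hC)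
        have h1 := h.blockRank_lt hconn hG hR
        have h2 := hmax C hC
        have h3 : blockRank G B B ≤ 0 := Finset.sup_le fun x hx => (rootDist_eq_zero hx).le
        omega
      obtain ⟨ψ', hψ'⟩ := hf.exists_respectsOn_root hconn hG hR hk index ψ
      refine ⟨ψ', by simpa [hs0] using hψ', fun C hC P c h => ?_⟩
      rw [hs0, Finset.insert_empty, Finset.mem_singleton] at hC
      exact (h.child_ne_root hC).elim
    · obtain ⟨P, c, h⟩ := exists_isChild hconn hG hR hB hBR
      have hPs : P ∈ s := (Finset.mem_insert.mp
        (hclosed B (Finset.mem_insert_self _ _) P c h)).resolve_left h.ne.symm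
      obtain ⟨ψ', hoff, hres, hcov'⟩ := hf.exists_respectsOn_child hconn hG hclaw hR hk hW index h
        (hψ P hPs)
      -- Recoloring `B \ {c}` leaves the earlier blocks intact: a vertex shared with one of them is
      -- the cut vertex of a child-parent pair, and by rank `B` is the child, so the vertex is `c`.
      have heq : ∀ C ∈ s, ∀ x ∈ C, ψ' x = ψ x := by
        intro C hC x hx
        refine hoff x fun hx' => ?_
        obtain ⟨hxc, hxB⟩ := Finset.mem_erase.mp hx'
        have hCb := hs C (Finset.mem_insert_of_mem hC)
        have hCB : C ≠ B := fun h => hBs (h ▸ hC)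
        obtain ⟨D, Q, hD⟩ := exists_isChild_of_mem_of_mem hconn hG hR hCb hB hCB hx hxB
        rcases hclaw.block_eq_or_eq hG hCb hB hD.block_child hx hxB hD.mem_child hCB with rfl | rfl
        · rcases hclaw.block_eq_or_eq hG hCb hB hD.block_parent hx hxB hD.mem_parent hCB
            with rfl | rfl
          · exact hD.ne rfl
          · have := hD.blockRank_lt hconn hG hR
            have := hmax D hC
            omega
        · exact hxc (h.cutVertex_eq hconn hR hD)
      refine ⟨ψ', ?_, ?_⟩
      · intro C hC
        rcases Finset.mem_insert.mp hC with rfl | hC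
        · exact hres
        · exact (hψ C hC).congr (heq C hC)
      · intro C hC Q b hb hbW
        rcases Finset.mem_insert.mp hC with rfl | hC
        · obtain ⟨rfl, rfl⟩ := h.parent_eq hconn hG hclaw hR hb
          exact hcov' hbW
        · have hQ := hclosed' C hC Q b hb
          intro j hj
          rw [heq C hC b hb.mem_child] at hj
          obtain ⟨v, hv, hvb, hvj⟩ := hcov C hC Q b hb hbW j hj
          refine ⟨v, hv, hvb, ?_⟩
          rw [← hvj]
          exact hv.elim (heq C hC v) (heq Q hQ v)

theorem IsFlow.exists_isFlowColoring (hf : IsFlow (flowNetwork G R k W) f)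
    (hconn : G.Connected) (hG : IsBlockGraph G) (hclaw : IsClawFree G) (hR : IsBlock G R)
    (hk : G.cliqueNum < k) (hW : (W : Set V) ⊆ denseSet G k) (index : W ↪ Fin k) :
    ∃ ψ : G.Coloring (Fin k), IsFlowColoring index f ψ ∧ RealizesDistinct ψ W := by
  classical
  obtain ⟨ψ, hψ, hcov⟩ := hf.exists_respectsOn_of_closed hconn hG hclaw hR hk hW index
    (Finset.univ.filter (IsBlock G)) (by simp)
    (fun C _ P c h => by simpa using h.block_parent)
  simp only [Finset.mem_filter, Finset.mem_univ, true_and] at hψ hcov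
  have hsource : ∀ w : W, ∀ x, x ∈ W → .source x ∈ f w → ψ x = index w := by
    intro w x hx hw
    obtain ⟨C, P, h⟩ := exists_isChild_of_mem_denseSet hconn hG hR hk (hW hx)
    exact (hψ C h.block_child).eq_of_vert_mem w x h.mem_child
      (hf.vert_mem_of_source_mem hG hclaw h hw)
  have hindex : ∀ w : W, ψ w = index w := fun w => hsource w w w.2 (hf.source_mem w)
  refine ⟨SimpleGraph.Coloring.mk ψ fun {u v} huv heq => ?_, ?_, fun w hw => ?_, ?_⟩
  · obtain ⟨B, hB, hu, hv⟩ := exists_isBlock_of_adj huv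
    exact huv.ne ((hψ B hB).injOn hu hv heq)
  · rintro x ⟨w, γ, hγ, hrel⟩
    refine ⟨w, ?_, γ, hγ, hrel⟩
    change index w = ψ x
    rcases hrel with ⟨B, hB, hx, rfl⟩ | ⟨hx, rfl⟩
    · exact ((hψ B hB).eq_of_vert_mem w x hx hγ).symm
    · exact (hsource w x hx hγ).symm
  · obtain ⟨C, P, h⟩ := exists_isChild_of_mem_denseSet hconn hG hR hk (hW hw)
    refine ⟨ψ w, rfl, fun j hj => ?_⟩
    obtain ⟨v, hv, hvw, hvj⟩ := hcov C h.block_child P w h hw j hj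
    exact ⟨v, h.adj_of_mem hG hv hvw, hvj⟩
  · intro w hw v hv heq
    have h1 : ψ w = ψ v := heq
    have h2 : index ⟨w, hw⟩ = index ⟨v, hv⟩ := by
      rw [← hindex, ← hindex]
      exact h1
    simpa using index.injective h2

/-- Every path ends at a sink, and the sinks have total capacity `(k - |R|) + |R| = k`. -/
lemma IsFlow.card_le_colors (hf : IsFlow (flowNetwork G R k W) f)
    (hG : IsBlockGraph G) (hR : IsBlock G R) (hk : G.cliqueNum < k) : W.card ≤ k := by
  classical
  have hsub : (Finset.univ : Finset W) ⊆ (Finset.univ.filter fun w => Node.cash R ∈ f w) ∪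
      R.biUnion fun x => Finset.univ.filter fun w => Node.vert R x ∈ f w := by
    intro w _
    obtain ⟨t, ht, hlast⟩ := (hf.1 w).2.2
    have hmem := List.mem_of_getLast? hlast
    rcases ht with rfl | ⟨x, hx, rfl⟩
    · simp [hmem]
    · simp only [Finset.mem_union, Finset.mem_biUnion, Finset.mem_filter, Finset.mem_univ, true_and]
      exact .inr ⟨x, hx, hmem⟩
  have h1 := (Finset.card_le_card hsub).trans (Finset.card_union_le _ _)
  rw [Finset.card_univ, Fintype.card_coe] at h1
  have h2 : (Finset.univ.filter fun w => Node.cash R ∈ f w).card ≤ k - R.card :=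
    hf.card_le (γ := .cash R) (by simp) (by simp)
  have h3 : (R.biUnion fun x => Finset.univ.filter fun w => Node.vert R x ∈ f w).card
      ≤ R.card * 1 := Finset.card_biUnion_le_card_mul _ _ _ fun x _ =>
    hf.card_le (γ := .vert R x) (by simp) (by simp)
  have h4 := hG.card_lt hk hR
  omega

end FlowColorings

/-! ### From a coloring to a flow -/

section PathsOfColorings

variable {V : Type*} {G : SimpleGraph V} {R W : Finset V} {k : ℕ} {C P : Finset V} {c : V}

lemma IsChild.mem_of_adj [Finite V] (h : IsChild G R C P c) (hG : IsBlockGraph G)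
    (hclaw : IsClawFree G) {x : V} (hx : G.Adj c x) : x ∈ C ∨ x ∈ P := by
  obtain ⟨B, hB, hcB, hxB⟩ := exists_isBlock_of_adj hx
  rcases hclaw.block_eq_or_eq hG h.block_child h.block_parent hB h.mem_child h.mem_parent hcB
    h.ne with rfl | rfl
  · exact .inl hxB
  · exact .inr hxB

lemma IsBlockGraph.injOn_coloring (hG : IsBlockGraph G) (ψ : G.Coloring (Fin k)) {B : Finset V}
    (hB : IsBlock G B) : Set.InjOn ψ B := by
  intro x hx y hy hxy
  by_contra hne
  exact ψ.valid (hG B hB hx hy hne) hxy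

/-- The nodes of the flow network that a path of color `i` may use. -/
def OfColor (W : Finset V) (ψ : V → Fin k) (i : Fin k) : Node V → Prop
  | .vert _ x => ψ x = i
  | .cash B => ∀ x ∈ B, ψ x ≠ i
  | .link C P c => ψ c ≠ i ∧ (c ∈ W → (∃ x ∈ C, ψ x = i) ∧ ∃ x ∈ P, ψ x = i)
  | .source x => ψ x = i

/-- There is a directed walk from `γ` to a sink whose nodes may be used by a path of color `i`. -/
def ReachesSink (G : SimpleGraph V) (R W : Finset V) (ψ : V → Fin k) (i : Fin k)
    (γ : Node V) : Prop :=
  ∃ l : List (Node V), (γ :: l).IsChain (FlowArc G R W) ∧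
    (∀ δ ∈ γ :: l, IsNode G R W δ ∧ OfColor W ψ i δ) ∧
    ∃ t, (t = .cash R ∨ ∃ x ∈ R, t = .vert R x) ∧ (γ :: l).getLast? = some t

lemma ReachesSink.cons {ψ : V → Fin k} {i : Fin k} {γ δ : Node V}
    (h : ReachesSink G R W ψ i δ) (harc : FlowArc G R W γ δ) (hγ : IsNode G R W γ)
    (hi : OfColor W ψ i γ) : ReachesSink G R W ψ i γ := by
  obtain ⟨l, hl, hmem, t, ht, hlast⟩ := h
  refine ⟨δ :: l, List.isChain_cons_cons.mpr ⟨harc, hl⟩, ?_, t, ht, by simpa using hlast⟩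
  intro ε hε
  rcases List.mem_cons.mp hε with rfl | hε
  · exact ⟨hγ, hi⟩
  · exact hmem ε hε

/-- For `c ∈ W` the link is used only by colors present in both blocks. A color present in `C` but
missing from `P` takes the arc to `(P)`; a color missing from `C` must occur on `P`, since `c`
realizes its color. -/
lemma reachesSink_of_parent [Finite V] (hG : IsBlockGraph G) (hclaw : IsClawFree G)
    {ψ : G.Coloring (Fin k)} (hψ : RealizesDistinct ψ W) {i : Fin k} (h : IsChild G R C P c)
    (hvert : ∀ x ∈ P, ψ x = i → ReachesSink G R W ψ i (.vert P x))
    (hcash : (∀ x ∈ P, ψ x ≠ i) → ReachesSink G R W ψ i (.cash P)) :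
    (∀ x ∈ C, ψ x = i → ReachesSink G R W ψ i (.vert C x)) ∧
      ((∀ x ∈ C, ψ x ≠ i) → ReachesSink G R W ψ i (.cash C)) := by
  have hneP : ψ c ≠ i → ∀ x, ψ x = i → x ≠ c := by
    rintro hc x hx rfl
    exact hc hx
  constructor
  · intro x hx hxi
    have hnode : IsNode G R W (.vert C x) := .vert h.block_child hx
    by_cases hxc : x = c
    · subst hxc
      exact (hvert x h.mem_parent hxi).cons (.vert_vert h) hnode hxi
    have hci : ψ c ≠ i := fun hc =>
      hxc (hG.injOn_coloring ψ h.block_child hx h.mem_child (hxi.trans hc.symm))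
    by_cases hP : ∃ y ∈ P, ψ y = i
    · obtain ⟨y, hy, hyi⟩ := hP
      exact ((hvert y hy hyi).cons (.link_vert h hy (hneP hci y hyi)) (.link h)
        ⟨hci, fun _ => ⟨⟨x, hx, hxi⟩, ⟨y, hy, hyi⟩⟩⟩).cons (.vert_link h hx hxc) hnode hxi
    · push Not at hP
      by_cases hcW : c ∈ W
      · exact (hcash hP).cons (.vert_cash h hcW hx hxc) hnode hxi
      · exact ((hcash hP).cons (.link_cash h hcW) (.link h)
          ⟨hci, fun hc => (hcW hc).elim⟩).cons (.vert_link h hx hxc) hnode hxi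
  · intro hC
    have hnode : IsNode G R W (.cash C) := .cash h.block_child
    have hci : ψ c ≠ i := hC c h.mem_child
    by_cases hcW : c ∈ W
    · obtain ⟨j, hj, hreal⟩ := hψ.1 c hcW
      obtain ⟨y, hcy, hyi⟩ := hreal i fun hij => hci (hj.trans hij.symm)
      have hy := (h.mem_of_adj hG hclaw hcy).resolve_left fun hy => hC y hy hyi
      exact (hvert y hy hyi).cons (.cash_vert h hcW hy (hneP hci y hyi)) hnode hC
    · have hlink : OfColor W ψ i (.link C P c) := ⟨hci, fun hc => (hcW hc).elim⟩
      by_cases hP : ∃ y ∈ P, ψ y = i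
      · obtain ⟨y, hy, hyi⟩ := hP
        exact ((hvert y hy hyi).cons (.link_vert h hy (hneP hci y hyi)) (.link h) hlink).cons
          (.cash_link h hcW) hnode hC
      · push Not at hP
        exact ((hcash hP).cons (.link_cash h hcW) (.link h) hlink).cons
          (.cash_link h hcW) hnode hC

lemma reachesSink_of_isBlock [Finite V] (hconn : G.Connected) (hG : IsBlockGraph G)
    (hclaw : IsClawFree G) (hR : IsBlock G R) {ψ : G.Coloring (Fin k)}
    (hψ : RealizesDistinct ψ W) (i : Fin k) {B : Finset V} (hB : IsBlock G B) :
    (∀ x ∈ B, ψ x = i → ReachesSink G R W ψ i (.vert B x)) ∧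
      ((∀ x ∈ B, ψ x ≠ i) → ReachesSink G R W ψ i (.cash B)) := by
  induction hn : blockRank G R B using Nat.strong_induction_on generalizing B with
  | _ n ih =>
    by_cases hBR : B = R
    · subst hBR
      refine ⟨fun x hx hxi => ⟨[], by simp, ?_, .vert B x, by simp [hx], by simp⟩,
        fun hi => ⟨[], by simp, ?_, .cash B, by simp, by simp⟩⟩
      · simpa using ⟨IsNode.vert hB hx, hxi⟩
      · simpa using ⟨IsNode.cash hB, hi⟩
    · obtain ⟨P, c, h⟩ := exists_isChild hconn hG hR hB hBR
      have := ih _ (hn ▸ h.blockRank_lt hconn hG hR) h.block_parent rfl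
      exact reachesSink_of_parent hG hclaw hψ h this.1 this.2

lemma exists_finset_ofColor [Fintype V] [DecidableEq V] [DecidableRel G.Adj]
    (hG : IsBlockGraph G) (hclaw : IsClawFree G) (hk : G.cliqueNum < k)
    {ψ : G.Coloring (Fin k)} (hψ : RealizesDistinct ψ W) {γ : Node V} (hγ : IsNode G R W γ) :
    ∃ T : Finset (Fin k), (∀ i, OfColor W ψ i γ → i ∈ T) ∧ T.card ≤ nodeCap G k W γ := by
  classical
  cases hγ with
  | @vert B x hB hx => exact ⟨{ψ x}, fun i hi => by simpa using hi.symm, by simp [nodeCap]⟩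
  | @source C P c h hc => exact ⟨{ψ c}, fun i hi => by simpa using hi.symm, by simp [nodeCap]⟩
  | @cash B hB =>
    refine ⟨(B.image ψ)ᶜ, fun i hi => by simpa [OfColor] using hi, ?_⟩
    rw [Finset.card_compl, Finset.card_image_of_injOn (hG.injOn_coloring ψ hB), Fintype.card_fin]
    rfl
  | @link C P c h =>
    by_cases hcW : c ∈ W
    -- Inclusion-exclusion: the two images have `d(c)` elements in total and, as `c` realizes its
    -- color, at least `k - 1` in their union.
    · refine ⟨(C.erase c).image ψ ∩ (P.erase c).image ψ, ?_, ?_⟩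
      · rintro i ⟨hci, hi⟩
        obtain ⟨⟨x, hx, hxi⟩, ⟨y, hy, hyi⟩⟩ := hi hcW
        refine Finset.mem_inter.mpr ⟨Finset.mem_image.mpr ⟨x, Finset.mem_erase.mpr ⟨?_, hx⟩, hxi⟩,
          Finset.mem_image.mpr ⟨y, Finset.mem_erase.mpr ⟨?_, hy⟩, hyi⟩⟩
        · rintro rfl; exact hci hxi
        · rintro rfl; exact hci hyi
      · have hinj : ∀ B, IsBlock G B → c ∈ B → ((B.erase c).image ψ).card + 1 = B.card := by
          intro B hB hc
          rw [Finset.card_image_of_injOn ((hG.injOn_coloring ψ hB).mono (by simp)),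
            Finset.card_erase_add_one hc]
        have h1 := hinj C h.block_child h.mem_child
        have h2 := hinj P h.block_parent h.mem_parent
        have h3 := Finset.card_union_add_card_inter ((C.erase c).image ψ) ((P.erase c).image ψ)
        have h4 := h.card_add_card hG hclaw
        have h5 : Finset.univ.erase (ψ c) ⊆ (C.erase c).image ψ ∪ (P.erase c).image ψ := by
          intro i hi
          obtain ⟨j, hj, hreal⟩ := hψ.1 c hcW
          obtain ⟨y, hcy, hyi⟩ := hreal i fun hij =>
            (Finset.mem_erase.mp hi).1 (hij.trans hj.symm)
          rw [Finset.mem_union]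
          exact (h.mem_of_adj hG hclaw hcy).imp
            (fun hy => Finset.mem_image.mpr ⟨y, Finset.mem_erase.mpr ⟨hcy.ne', hy⟩, hyi⟩)
            (fun hy => Finset.mem_image.mpr ⟨y, Finset.mem_erase.mpr ⟨hcy.ne', hy⟩, hyi⟩)
        have h6 := Finset.card_le_card h5
        rw [Finset.card_erase_of_mem (Finset.mem_univ _), Finset.card_univ, Fintype.card_fin] at h6
        simp only [nodeCap, hcW, if_true]
        omega
    · refine ⟨Finset.univ.erase (ψ c), fun i hi => by simpa [eq_comm] using hi.1, ?_⟩
      rw [Finset.card_erase_of_mem (Finset.mem_univ _), Finset.card_univ, Fintype.card_fin]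
      simp [nodeCap, hcW]

theorem exists_isFlow_of_coloring [Fintype V] [DecidableEq V] [DecidableRel G.Adj]
    (hconn : G.Connected) (hG : IsBlockGraph G) (hclaw : IsClawFree G) (hR : IsBlock G R)
    (hk : G.cliqueNum < k) (hW : (W : Set V) ⊆ denseSet G k) (ψ : G.Coloring (Fin k))
    (hψ : RealizesDistinct ψ W) :
    ∃ (f : W → List (Node V)) (index : W ↪ Fin k), IsFlow (flowNetwork G R k W) f ∧
      (∀ w : W, index w = ψ w) ∧ IsFlowColoring index f ψ := by
  have hpath : ∀ w : W, ReachesSink G R W ψ (ψ w) (.source (w : V)) := by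
    intro w
    obtain ⟨C, P, h⟩ := exists_isChild_of_mem_denseSet hconn hG hR hk (hW w.2)
    exact ((reachesSink_of_isBlock hconn hG hclaw hR hψ (ψ w) h.block_child).1 w h.mem_child
      rfl).cons (.source_vert h w.2) (.source h w.2) rfl
  choose l hchain hmem hsink using hpath
  refine ⟨fun w => .source (w : V) :: l w,
    ⟨fun w => ψ w, fun w v h => Subtype.ext (hψ.2 w.2 v.2 h)⟩, ⟨fun w => ⟨⟨by simp,
      fun γ hγ => (hmem w γ hγ).1, hchain w, nodup_of_isChain hconn hG hR (hchain w)⟩,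
      rfl, hsink w⟩, ?_⟩, fun _ => rfl, ?_⟩
  · intro γ hγ _
    obtain ⟨T, hT, hcard⟩ := exists_finset_ofColor (R := R) hG hclaw hk hψ hγ
    refine le_trans ?_ hcard
    rw [← Set.ncard_coe_finset]
    exact Set.ncard_le_ncard_of_injOn (fun w : W => ψ w) (fun w hw => hT _ (hmem w γ hw).2)
      (fun w _ v _ h => Subtype.ext (hψ.2 w.2 v.2 h)) T.finite_toSet
  · rintro x ⟨w, γ, hγ, hrel⟩
    refine ⟨w, ?_, γ, hγ, hrel⟩
    have := (hmem w γ hγ).2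
    rcases hrel with ⟨B, hB, hx, rfl⟩ | ⟨hx, rfl⟩ <;> exact this.symm

end PathsOfColorings

end BlockFlow

theorem theorem1 {V : Type*} [Fintype V] [DecidableEq V] (G : SimpleGraph V) [DecidableRel G.Adj]
    (hconn : G.Connected) (hblock : IsBlockGraph G) (hclaw : IsClawFree G)
    (R : Finset V) (hR : IsBlock G R) (k : ℕ) (hk : G.cliqueNum < k)
    (W : Finset V) (hW : (W : Set V) ⊆ denseSet G k) :
    ((∃ f : W → List (Node V), IsFlow (flowNetwork G R k W) f) ↔
      ∃ ψ : G.Coloring (Fin k), RealizesDistinct ψ W) ∧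
    (∀ f : W → List (Node V), IsFlow (flowNetwork G R k W) f → ∀ index : W ↪ Fin k,
      ∃ ψ : G.Coloring (Fin k), IsFlowColoring index f ψ ∧ RealizesDistinct ψ W) ∧
    (∀ ψ : G.Coloring (Fin k), RealizesDistinct ψ W →
      ∃ (f : W → List (Node V)) (index : W ↪ Fin k), IsFlow (flowNetwork G R k W) f ∧
        (∀ w : W, index w = ψ w) ∧ IsFlowColoring index f ψ) := by
  have forward : ∀ f : W → List (Node V), IsFlow (flowNetwork G R k W) f → ∀ index : W ↪ Fin k,
      ∃ ψ : G.Coloring (Fin k), IsFlowColoring index f ψ ∧ RealizesDistinct ψ W :=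
    fun f hf index => hf.exists_isFlowColoring hconn hblock hclaw hR hk hW index
  have backward := exists_isFlow_of_coloring hconn hblock hclaw hR hk hW
  refine ⟨⟨?_, ?_⟩, forward, backward⟩
  · rintro ⟨f, hf⟩
    -- A bare flow comes without a numbering; one exists because `|W| ≤ k`.
    obtain ⟨index⟩ : Nonempty (W ↪ Fin k) := Function.Embedding.nonempty_of_card_le (by
      simpa using hf.card_le_colors hblock hR hk)
    obtain ⟨ψ, -, hψ⟩ := forward f hf index
    exact ⟨ψ, hψ⟩
  · rintro ⟨ψ, hψ⟩
    obtain ⟨f, -, hf, -⟩ := backward ψ hψ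
    exact ⟨f, hf⟩
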